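/- Let $(E,d_E)$ be a complete separable metric space with its Borel $\sigma$-algebra, $p$ a Borel probability measure on $E$, and $X=E^{\mathbb N}$ with the metric $d(x,y)=\sum_{n\ge 1}2^{-n}\min\{d_E(x_n,y_n),1\}$. Let $0<\alpha<1$. For $\varphi:X\to\mathbb R$ put $D_\alpha(\varphi)=\sup_{x\ne y}|\varphi(x)-\varphi(y)|/d(x,y)^\alpha$, and let $\mathrm{Hol}(\alpha)$ be the space of bounded continuous $\varphi:X\to\mathbb R$ with $D_\alpha(\varphi)<\infty$, with norm $\|\varphi\|_\alpha=\|\varphi\|_\infty+D_\alpha(\varphi)$. Let $f\in\mathrm{Hol}(\alpha)$ and $$L_f\varphi(x)=\int_E e^{f(ax)}\varphi(ax)\,dp(a),\qquad ax=(a,x_1,x_2,\dots).$$ Then there are a Borel probability measure $\nu$ on $X$ and $\lambda>0$ with $\int L_f\varphi\,d\nu=\lambda\int\varphi\,d\nu$ for all bounded continuous $\varphi$, such that the limit $h(x)=\lim_{n\to\infty}L_f^n(1)(x)/\int L_f^n(1)\,d\nu$ exists for every $x\in X$. For all such $\nu,\lambda,h$ the following holds. 1. The formulas $Q(\varphi)=L_f(h\varphi)/(\lambda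 h)$ and $\Pi(\varphi)=\int\varphi h\,d\nu$ (a constant function) define bounded linear operators $Q,\Pi$ on $(\mathrm{Hol}(\alpha),\|\cdot\|_\alpha)$, and $\Pi Q=Q\Pi=\Pi$. 2. Call $s\in(0,1)$ a decay rate if for every $\psi\in\mathrm{Hol}(\alpha)$ with $\inf\psi>0$ there is $C>0$ such that for all $\varphi\in\mathrm{Hol}(\alpha)$ and all $n\ge 0$ $$D_\alpha\!\left(\frac{L_f^n\varphi}{L_f^n\psi}-\frac{\nu(\varphi)}{\nu(\psi)}\right)\le C s^n\left(D_\alpha(\varphi)+\left|\frac{\nu(\varphi)}{\nu(\psi)}\right|D_\alpha(\psi)\right)\|1/\psi\|_\infty,$$ where $\nu(\varphi)=\int\varphi\,d\nu$. Decay rates $s\in(0,1)$ exist, and for every decay rate $s\in(0,1)$ there is $C>0$ such that $\|(Q-\Pi)^n\|_\alpha\le C s^n$ (operator norm) for all $n\ge0$. 3. $\mathrm{Hol}(\alpha)=\mathbb R\oplus\ker\Pi$, where $\mathbb R$ denotes the constant functions; both summands are closed, both are invariant under $Q$ and under $\Pi$, and $Q|_{\mathbb R}=\Pi|_{\mathbb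 R}=\mathrm{id}$. -/

import Mathlib

open MeasureTheory Filter Topology
open scoped NNReal ENNReal BoundedContinuousFunction

noncomputable section

/-- The full one-sided shift space `X = E^ℕ`; the coordinates `x₁, x₂, …` are indexed from `0`. -/
def ShiftSpace (E : Type*) : Type _ := ℕ → E

namespace ShiftSpace

variable {E : Type*}

/-- The point `a x = (a, x₁, x₂, …)`. -/
def cons (a : E) (x : ShiftSpace E) : ShiftSpace E := fun n => Nat.casesOn n a x

section Metric

variable [MetricSpace E]

/-- `d_X(x, y) = ∑_{n ≥ 1} 2⁻ⁿ min(d_E(xₙ, yₙ), 1)`. -/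
instance : Dist (ShiftSpace E) :=
  ⟨fun x y => ∑' n : ℕ, (1 / 2 : ℝ) ^ (n + 1) * min (dist (x n) (y n)) 1⟩

theorem dist_def (x y : ShiftSpace E) :
    dist x y = ∑' n : ℕ, (1 / 2 : ℝ) ^ (n + 1) * min (dist (x n) (y n)) 1 := rfl

theorem summable_dist (x y : ShiftSpace E) :
    Summable fun n : ℕ => (1 / 2 : ℝ) ^ (n + 1) * min (dist (x n) (y n)) 1 := by
  refine Summable.of_nonneg_of_le (fun n => by positivity) (fun n => ?_)
    ((summable_nat_add_iff 1).2 summable_geometric_two)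
  exact mul_le_of_le_one_right (by positivity) (min_le_right _ _)

instance : MetricSpace (ShiftSpace E) where
  dist_self x := by simp [dist_def]
  dist_comm x y := by simp only [dist_def, dist_comm]
  dist_triangle x y z := by
    rw [dist_def x z, dist_def x y, dist_def y z,
      ← (summable_dist x y).tsum_add (summable_dist y z)]
    refine (summable_dist x z).tsum_le_tsum (fun n => ?_)
      ((summable_dist x y).add (summable_dist y z))
    rw [← mul_add]
    refine mul_le_mul_of_nonneg_left ?_ (by positivity)
    have h := dist_triangle (x n) (y n) (z n)
    have h1 : 0 ≤ dist (x n) (y n) := dist_nonneg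
    have h2 : 0 ≤ dist (y n) (z n) := dist_nonneg
    rcases le_total (dist (x n) (y n)) 1 with h3 | h3 <;>
    rcases le_total (dist (y n) (z n)) 1 with h4 | h4 <;>
    rcases le_total (dist (x n) (z n)) 1 with h5 | h5 <;>
    simp only [min_eq_left, min_eq_right, h3, h4, h5] <;> linarith
  eq_of_dist_eq_zero {x y} h := by
    funext n
    have h1 : (1 / 2 : ℝ) ^ (n + 1) * min (dist (x n) (y n)) 1 = 0 :=
      le_antisymm (h ▸ (summable_dist x y).le_tsum n (fun k _ => by positivity)) (by positivity)
    have h2 : (0 : ℝ) < (1 / 2) ^ (n + 1) := by positivity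
    have h3 : min (dist (x n) (y n)) 1 = 0 := by
      rcases mul_eq_zero.1 h1 with h4 | h4
      · exact absurd h4 h2.ne'
      · exact h4
    rcases le_total (dist (x n) (y n)) 1 with h4 | h4
    · rw [min_eq_left h4] at h3
      exact dist_eq_zero.1 h3
    · rw [min_eq_right h4] at h3
      exact absurd h3 one_ne_zero

/-- The Borel sigma-algebra of the metric `d_X`. -/
instance : MeasurableSpace (ShiftSpace E) := borel _

instance : BorelSpace (ShiftSpace E) := ⟨rfl⟩

end Metric

end ShiftSpace

section Holder

/-- The bounded continuous functions `φ : X → ℝ` with finite Hölder seminorm. Mathlib's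
`eHolderNorm α φ` (least `α`-Hölder constant, in `[0, ∞]`) is
`D_α(φ) = sup_{x ≠ y} |φ x - φ y| / d(x, y)^α`, and `MemHolder α φ` says that it is finite. -/
def holSubmodule (X : Type*) [MetricSpace X] (α : ℝ≥0) : Submodule ℝ (X →ᵇ ℝ) where
  carrier := {φ | MemHolder α φ}
  add_mem' hf hg := MemHolder.add hf hg
  zero_mem' := memHolder_zero
  smul_mem' _ _ hf := MemHolder.smul hf

/-- The space `Hol(α)`; it is a type of its own, because it carries the norm
`‖φ‖_α = ‖φ‖_∞ + D_α(φ)` and not the supremum norm. -/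
def Hol (X : Type*) [MetricSpace X] (α : ℝ≥0) : Type _ := holSubmodule X α

namespace Hol

variable {X : Type*} [MetricSpace X] {α : ℝ≥0}

instance : AddCommGroup (Hol X α) := inferInstanceAs (AddCommGroup (holSubmodule X α))

instance : Module ℝ (Hol X α) := inferInstanceAs (Module ℝ (holSubmodule X α))

/-- The underlying bounded continuous function. -/
def toBCF (φ : Hol X α) : X →ᵇ ℝ := φ.1

instance : CoeFun (Hol X α) (fun _ => X → ℝ) := ⟨fun φ => φ.toBCF⟩

theorem memHolder (φ : Hol X α) : MemHolder α (φ : X → ℝ) := φ.2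

/-- `‖φ‖_α = ‖φ‖_∞ + D_α(φ)`. -/
instance : Norm (Hol X α) := ⟨fun φ => ‖φ.toBCF‖ + nnHolderNorm α (φ : X → ℝ)⟩

theorem norm_def (φ : Hol X α) : ‖φ‖ = ‖φ.toBCF‖ + nnHolderNorm α (φ : X → ℝ) := rfl

theorem normCore : NormedSpace.Core ℝ (Hol X α) where
  norm_nonneg φ := by rw [norm_def]; positivity
  norm_smul c φ := by
    have h : nnHolderNorm α ((c • φ : Hol X α) : X → ℝ)
        = ‖c‖₊ * nnHolderNorm α (φ : X → ℝ) := φ.memHolder.nnHolderNorm_smul c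
    have h2 : ‖(c • φ).toBCF‖ = ‖c‖ * ‖φ.toBCF‖ := norm_smul c φ.toBCF
    rw [norm_def, norm_def, h, h2, NNReal.coe_mul, coe_nnnorm]
    ring
  norm_triangle φ ψ := by
    have h : nnHolderNorm α ((φ + ψ : Hol X α) : X → ℝ)
        ≤ nnHolderNorm α (φ : X → ℝ) + nnHolderNorm α (ψ : X → ℝ) :=
      φ.memHolder.nnHolderNorm_add_le ψ.memHolder
    have h2 : ‖(φ + ψ).toBCF‖ ≤ ‖φ.toBCF‖ + ‖ψ.toBCF‖ := norm_add_le φ.toBCF ψ.toBCF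
    have h3 : (nnHolderNorm α ((φ + ψ : Hol X α) : X → ℝ) : ℝ)
        ≤ nnHolderNorm α (φ : X → ℝ) + nnHolderNorm α (ψ : X → ℝ) := by exact_mod_cast h
    rw [norm_def, norm_def, norm_def]
    linarith
  norm_eq_zero_iff φ := by
    constructor
    · intro h
      rw [norm_def] at h
      have h1 : 0 ≤ ‖φ.toBCF‖ := norm_nonneg _
      have h2 : (0 : ℝ) ≤ nnHolderNorm α (φ : X → ℝ) := NNReal.coe_nonneg _
      exact Subtype.ext (norm_eq_zero.1 (le_antisymm (by linarith) h1) : φ.toBCF = 0)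
    · rintro rfl
      have h1 : (0 : Hol X α).toBCF = 0 := rfl
      rw [norm_def, h1]
      simp

instance : NormedAddCommGroup (Hol X α) := NormedAddCommGroup.ofCore normCore

instance : NormedSpace ℝ (Hol X α) := NormedSpace.ofCore normCore

/-- The constant functions, as a subspace of `Hol(α)`. -/
def constants (X : Type*) [MetricSpace X] (α : ℝ≥0) : Submodule ℝ (Hol X α) where
  carrier := {φ | ∃ c : ℝ, ∀ x, φ x = c}
  add_mem' := by
    rintro φ ψ ⟨a, ha⟩ ⟨b, hb⟩
    refine ⟨a + b, fun x => ?_⟩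
    rw [← ha x, ← hb x]
    rfl
  zero_mem' := ⟨0, fun _ => rfl⟩
  smul_mem' := by
    rintro c φ ⟨a, ha⟩
    refine ⟨c * a, fun x => ?_⟩
    rw [← ha x]
    rfl

end Hol

end Holder

section Ruelle

variable {E : Type*} [MetricSpace E] [MeasurableSpace E]

/-- The Ruelle operator `L_f φ (x) = ∫ exp(f(ax)) φ(ax) dp(a)` with a priori measure `p`. -/
def ruelle (p : Measure E) (f φ : ShiftSpace E → ℝ) : ShiftSpace E → ℝ :=
  fun x => ∫ a, Real.exp (f (ShiftSpace.cons a x)) * φ (ShiftSpace.cons a x) ∂p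

/-- The Perron-Frobenius-Ruelle data of `f`: a Borel probability measure `ν` with
`L_f^* ν = lam ν`, `lam > 0`, and the function `h = lim_n L_f^n(1) / ∫ L_f^n(1) dν`. -/
structure IsPFRData (p : Measure E) (f : ShiftSpace E → ℝ)
    (ν : Measure (ShiftSpace E)) (lam : ℝ) (h : ShiftSpace E → ℝ) : Prop where
  isProbabilityMeasure : IsProbabilityMeasure ν
  lam_pos : 0 < lam
  conformal : ∀ φ : ShiftSpace E →ᵇ ℝ, ∫ x, ruelle p f φ x ∂ν = lam * ∫ x, φ x ∂ν
  tendsto_h : ∀ x, Tendsto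
    (fun n : ℕ => (ruelle p f)^[n] 1 x / ∫ y, (ruelle p f)^[n] 1 y ∂ν) atTop (𝓝 (h x))

/-- `s` is a rate of the exponential decay of ratios of iterates of the Ruelle operator on
`Hol(α)`: for every `ψ ∈ Hol(α)` with `inf ψ > 0` there is `C > 0` such that, for all
`φ ∈ Hol(α)` and all `n`,
`D_α(L^n φ / L^n ψ - ν(φ)/ν(ψ)) ≤ C s^n (D_α(φ) + |ν(φ)/ν(ψ)| D_α(ψ)) ‖1/ψ‖_∞`. -/
def IsDecayRate (p : Measure E) (f : ShiftSpace E → ℝ) (ν : Measure (ShiftSpace E))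
    (α : ℝ≥0) (s : ℝ) : Prop :=
  ∀ ψ : Hol (ShiftSpace E) α, (∃ c : ℝ, 0 < c ∧ ∀ x, c ≤ ψ x) →
    ∃ C : ℝ, 0 < C ∧ ∀ (φ : Hol (ShiftSpace E) α) (n : ℕ),
      eHolderNorm α (fun x =>
          (ruelle p f)^[n] φ x / (ruelle p f)^[n] ψ x - (∫ y, φ y ∂ν) / ∫ y, ψ y ∂ν)
        ≤ ENNReal.ofReal (C * s ^ n *
            (nnHolderNorm α (φ : ShiftSpace E → ℝ)
              + |(∫ y, φ y ∂ν) / ∫ y, ψ y ∂ν| * nnHolderNorm α (ψ : ShiftSpace E → ℝ))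
            * ⨆ x, |1 / ψ x|)

end Ruelle

end

/-!
Call a positive function `w` log-Hölder if `log w` is `α`-Hölder with the distortion constant of
`f`; since `x ↦ a x` contracts distances by `1/2`, the operator `L_f` preserves this class. For
such `w`, `L_f v / L_f w` averages `v / w` over the preimages of a point, with weights of
controlled distortion, so the ratios `L_f^n v / L_f^n w` have Hölder seminorm `O(r^n)` with some
`r < 1` independent of `w`. The rest follows from this contraction:

* every limit point of the orbits of the normalized dual operator (they are tight) is a fixed point,
  i.e. a conformal measure, because the operator contracts the integrals of Lipschitz functions;
* `λ^{-n} L_f^n 1` converges to a log-Hölder eigenfunction `h` with `∫ h dν = 1`, and `Q^n - Π`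
  decays like `r^n`, because a function of mean `0` is bounded by its oscillation.

A decay rate `s` bounds `(Q - Π)^n = Q^n - Π`, `n ≥ 1`, through the choice `ψ = h`, for which
`L_f^n h = λ^n h`.
-/

noncomputable section

/-! ### Hölder functions -/

/-- The Hölder estimate of `HolderWith`, with a real constant in place of a nonnegative one. -/
def HolderBound {X : Type*} [PseudoMetricSpace X] (α : ℝ≥0) (B : ℝ) (g : X → ℝ) : Prop :=
  ∀ x y, |g x - g y| ≤ B * dist x y ^ (α : ℝ)

section HolderBound

variable {X : Type*} [PseudoMetricSpace X] {α C : ℝ≥0} {B : ℝ} {g : X → ℝ}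

theorem holderBound_coe_iff : HolderBound α C g ↔ HolderWith C α g := by
  refine forall₂_congr fun x y => ?_
  have h : (C : ℝ≥0∞) * edist x y ^ (α : ℝ) = ENNReal.ofReal (C * dist x y ^ (α : ℝ)) := by
    rw [ENNReal.ofReal_mul C.coe_nonneg, ENNReal.ofReal_coe_nnreal, edist_dist,
      ENNReal.ofReal_rpow_of_nonneg dist_nonneg α.coe_nonneg]
  rw [h, edist_dist, Real.dist_eq, ENNReal.ofReal_le_ofReal_iff (by positivity)]

namespace HolderBound

theorem of_sub_le (h : ∀ x y, g x - g y ≤ B * dist x y ^ (α : ℝ)) : HolderBound α B g :=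
  fun x y => abs_sub_le_iff.2 ⟨h x y, dist_comm x y ▸ h y x⟩

theorem mono {B' : ℝ} (h : HolderBound α B g) (hB : B ≤ B') : HolderBound α B' g := fun x y =>
  (h x y).trans (mul_le_mul_of_nonneg_right hB (by positivity))

theorem sub_const (h : HolderBound α B g) (c : ℝ) : HolderBound α B (fun x => g x - c) :=
  fun x y => by simpa only [sub_sub_sub_cancel_right] using h x y

theorem sub_const_mul {g' : X → ℝ} {B' : ℝ} (h : HolderBound α B g) (h' : HolderBound α B' g')
    (k : ℝ) : HolderBound α (B + |k| * B') (fun x => g x - k * g' x) := fun x y => by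
  calc |g x - k * g' x - (g y - k * g' y)| = |(g x - g y) - k * (g' x - g' y)| := by ring_nf
    _ ≤ |g x - g y| + |k| * |g' x - g' y| := (abs_sub _ _).trans_eq (by rw [abs_mul])
    _ ≤ B * dist x y ^ (α : ℝ) + |k| * (B' * dist x y ^ (α : ℝ)) :=
        add_le_add (h x y) (mul_le_mul_of_nonneg_left (h' x y) (abs_nonneg k))
    _ = (B + |k| * B') * dist x y ^ (α : ℝ) := by ring

theorem mul {g' : X → ℝ} {B' M M' : ℝ} (h : HolderBound α B g) (h' : HolderBound α B' g')
    (hM : ∀ x, |g x| ≤ M) (hM' : ∀ x, |g' x| ≤ M') :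
    HolderBound α (M * B' + M' * B) (fun x => g x * g' x) := fun x y => by
  calc |g x * g' x - g y * g' y| = |g x * (g' x - g' y) + g' y * (g x - g y)| := by ring_nf
    _ ≤ |g x| * |g' x - g' y| + |g' y| * |g x - g y| := by
        simpa only [abs_mul] using abs_add_le (g x * (g' x - g' y)) (g' y * (g x - g y))
    _ ≤ M * (B' * dist x y ^ (α : ℝ)) + M' * (B * dist x y ^ (α : ℝ)) :=
        add_le_add
          (mul_le_mul (hM x) (h' x y) (abs_nonneg _) ((abs_nonneg _).trans (hM x)))
          (mul_le_mul (hM' y) (h x y) (abs_nonneg _) ((abs_nonneg _).trans (hM' y)))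
    _ = (M * B' + M' * B) * dist x y ^ (α : ℝ) := by ring

theorem inv {m : ℝ} (h : HolderBound α B g) (hm : 0 < m) (hg : ∀ x, m ≤ g x) :
    HolderBound α (B / m ^ 2) (fun x => (g x)⁻¹) := fun x y => by
  have hx := hm.trans_le (hg x)
  have hy := hm.trans_le (hg y)
  rw [inv_sub_inv hx.ne' hy.ne', abs_div, abs_sub_comm, abs_of_pos (mul_pos hx hy),
    div_mul_eq_mul_div]
  refine div_le_div₀ ((abs_nonneg _).trans (h x y)) (h x y) (by positivity) ?_
  rw [sq]
  exact mul_le_mul (hg x) (hg y) hm.le hx.le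

theorem holderWith (h : HolderBound α B g) : HolderWith B.toNNReal α g :=
  holderBound_coe_iff.1 (h.mono (Real.le_coe_toNNReal B))

theorem eHolderNorm_le (h : HolderBound α B g) : eHolderNorm α g ≤ ENNReal.ofReal B :=
  h.holderWith.eHolderNorm_le

theorem exists_abs_le [BoundedSpace X] (h : HolderBound α B g) : ∃ M, ∀ x, |g x| ≤ M := by
  obtain _ | ⟨⟨x₀⟩⟩ := isEmpty_or_nonempty X
  · exact ⟨0, isEmptyElim⟩
  obtain ⟨R, hR⟩ := (Metric.isBounded_iff.1 (Bornology.IsBounded.all (Set.univ : Set X)))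
  refine ⟨|g x₀| + |B| * R ^ (α : ℝ), fun x => ?_⟩
  have hx : |g x - g x₀| ≤ |B| * R ^ (α : ℝ) := (h x x₀).trans <|
    mul_le_mul (le_abs_self B)
      (Real.rpow_le_rpow dist_nonneg (hR trivial trivial) α.coe_nonneg) (by positivity)
      (abs_nonneg B)
  linarith [abs_sub_abs_le_abs_sub (g x) (g x₀)]

end HolderBound

end HolderBound

namespace HolderBound

variable {X : Type*} [MetricSpace X] {α : ℝ≥0} {B : ℝ} {g : X → ℝ}

theorem nnHolderNorm_le (h : HolderBound α B g) (hB : 0 ≤ B) : (nnHolderNorm α g : ℝ) ≤ B := by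
  have h1 := h.holderWith.nnholderNorm_le
  rwa [← NNReal.coe_le_coe, Real.coe_toNNReal B hB] at h1

theorem of_eHolderNorm_le (hB : 0 ≤ B)
    (h : eHolderNorm α g ≤ ENNReal.ofReal B) : HolderBound α B g := by
  have hg : MemHolder α g := eHolderNorm_lt_top.1 (h.trans_lt ENNReal.ofReal_lt_top)
  refine (holderBound_coe_iff.2 hg.holderWith).mono ?_
  rw [← hg.coe_nnHolderNorm_eq_eHolderNorm] at h
  exact (ENNReal.ofReal_le_ofReal_iff hB).1 (by rwa [ENNReal.ofReal_coe_nnreal])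

end HolderBound

namespace Hol

variable {X : Type*} [MetricSpace X] {α : ℝ≥0}

theorem holderBound (φ : Hol X α) : HolderBound α (nnHolderNorm α (φ : X → ℝ)) φ :=
  holderBound_coe_iff.2 φ.memHolder.holderWith

theorem holderBound_norm (φ : Hol X α) : HolderBound α ‖φ‖ φ :=
  φ.holderBound.mono (le_add_of_nonneg_left (norm_nonneg _))

theorem norm_toBCF_le (φ : Hol X α) : ‖φ.toBCF‖ ≤ ‖φ‖ :=
  le_add_of_nonneg_right (NNReal.coe_nonneg _)

theorem abs_le_norm (φ : Hol X α) (x : X) : |φ x| ≤ ‖φ‖ :=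
  (φ.toBCF.norm_coe_le_norm x).trans φ.norm_toBCF_le

theorem norm_le_add (φ : Hol X α) {M B : ℝ} (hM₀ : 0 ≤ M) (hB₀ : 0 ≤ B)
    (hM : ∀ x, |φ x| ≤ M) (hB : HolderBound α B φ) : ‖φ‖ ≤ M + B :=
  add_le_add ((BoundedContinuousFunction.norm_le hM₀).2 hM) (hB.nnHolderNorm_le hB₀)

@[ext]
theorem ext {φ ψ : Hol X α} (h : ∀ x, φ x = ψ x) : φ = ψ :=
  Subtype.ext (BoundedContinuousFunction.ext h)

theorem toBCF_add (φ ψ : Hol X α) : (φ + ψ).toBCF = φ.toBCF + ψ.toBCF := rfl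

theorem toBCF_sub (φ ψ : Hol X α) : (φ - ψ).toBCF = φ.toBCF - ψ.toBCF := rfl

theorem toBCF_smul (c : ℝ) (φ : Hol X α) : (c • φ).toBCF = c • φ.toBCF := rfl

@[simp] theorem add_apply (φ ψ : Hol X α) (x : X) : (φ + ψ) x = φ x + ψ x := rfl

@[simp] theorem sub_apply (φ ψ : Hol X α) (x : X) : (φ - ψ) x = φ x - ψ x := rfl

@[simp] theorem smul_apply (c : ℝ) (φ : Hol X α) (x : X) : (c • φ) x = c * φ x := rfl

instance : One (Hol X α) := ⟨⟨1, (HolderWith.const (y := (1 : ℝ)) (C := 0)).memHolder⟩⟩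

@[simp] theorem one_apply (x : X) : (1 : Hol X α) x = 1 := rfl

instance : Mul (Hol X α) :=
  ⟨fun φ ψ => ⟨φ.toBCF * ψ.toBCF, (φ.holderBound.mul ψ.holderBound φ.toBCF.norm_coe_le_norm
    ψ.toBCF.norm_coe_le_norm).holderWith.memHolder⟩⟩

@[simp] theorem mul_apply (φ ψ : Hol X α) (x : X) : (φ * ψ) x = φ x * ψ x := rfl

theorem norm_mul_le (φ ψ : Hol X α) : ‖φ * ψ‖ ≤ ‖φ‖ * ‖ψ‖ := by
  have hM : ‖(φ * ψ).toBCF‖ ≤ ‖φ.toBCF‖ * ‖ψ.toBCF‖ :=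
    _root_.norm_mul_le φ.toBCF ψ.toBCF
  have hB := HolderBound.nnHolderNorm_le (φ.holderBound.mul ψ.holderBound
    φ.toBCF.norm_coe_le_norm ψ.toBCF.norm_coe_le_norm) (by positivity)
  have h : (0 : ℝ) ≤ nnHolderNorm α (φ : X → ℝ) * nnHolderNorm α (ψ : X → ℝ) := by positivity
  rw [norm_def, norm_def, norm_def]
  exact (add_le_add hM hB).trans (by linarith)

section BoundedSpace

variable [BoundedSpace X]

/-- On a bounded space the elements of `Hol(α)`, `0 < α`, are the functions that satisfy some
Hölder estimate: continuity and boundedness follow from it. -/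
def ofHolderBound (hα : 0 < α) (g : X → ℝ) (h : ∃ B, HolderBound α B g) : Hol X α :=
  ⟨BoundedContinuousFunction.ofNormedAddCommGroup g (h.choose_spec.holderWith.continuous hα)
    _ h.choose_spec.exists_abs_le.choose_spec, h.choose_spec.holderWith.memHolder⟩

@[simp] theorem ofHolderBound_apply (hα : 0 < α) (g : X → ℝ) (h : ∃ B, HolderBound α B g)
    (x : X) : ofHolderBound hα g h x = g x := rfl

theorem exists_eq_inv (hα : 0 < α) (ψ : Hol X α) {m : ℝ} (hm : 0 < m) (hψ : ∀ x, m ≤ ψ x) :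
    ∃ ψ' : Hol X α, (∀ x, ψ' x = (ψ x)⁻¹) ∧ ‖ψ'‖ ≤ m⁻¹ + ‖ψ‖ / m ^ 2 := by
  have hB := ψ.holderBound_norm.inv hm hψ
  refine ⟨ofHolderBound hα _ ⟨_, hB⟩, fun _ => rfl,
    norm_le_add _ (by positivity) (by positivity) (fun x => ?_) hB⟩
  rw [ofHolderBound_apply, abs_of_pos (inv_pos.2 (hm.trans_le (hψ x)))]
  exact inv_anti₀ hm (hψ x)

end BoundedSpace

end Hol

theorem abs_sub_le_of_integral_sub_mul_eq_zero {X : Type*} [MeasurableSpace X] {ν : Measure X}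
    [IsProbabilityMeasure ν] {g w : X → ℝ} {c B : ℝ} (hw : ∀ x, 0 < w x)
    (hint : Integrable (fun x => (g x - c) * w x) ν) (h₀ : ∫ x, (g x - c) * w x ∂ν = 0)
    (hB : ∀ x y, |g x - g y| ≤ B) (x : X) : |g x - c| ≤ B := by
  obtain ⟨y, hy⟩ := exists_le_integral hint
  obtain ⟨z, hz⟩ := exists_integral_le hint
  rw [h₀] at hy hz
  have hyc : g y - c ≤ 0 := nonpos_of_mul_nonpos_left hy (hw y)
  have hzc : 0 ≤ g z - c := nonneg_of_mul_nonneg_left hz (hw z)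
  rw [abs_le]
  constructor <;> linarith [(abs_le.1 (hB x y)).2, (abs_le.1 (hB x z)).1]

/-! ### The shift space -/

namespace ShiftSpace

variable {E : Type*}

@[simp] theorem cons_zero (a : E) (x : ShiftSpace E) : cons a x 0 = a := rfl

@[simp] theorem cons_succ (a : E) (x : ShiftSpace E) (n : ℕ) : cons a x (n + 1) = x n := rfl

variable [MetricSpace E]

theorem dist_cons_cons (a b : E) (x y : ShiftSpace E) :
    dist (cons a x) (cons b y) = (1 / 2) * min (dist a b) 1 + dist x y / 2 := by
  have h : dist x y / 2 = ∑' n : ℕ, (1 / 2 : ℝ) ^ (n + 1 + 1) * min (dist (x n) (y n)) 1 := by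
    rw [dist_def x y, ← tsum_div_const]
    refine tsum_congr fun n => ?_
    rw [pow_succ _ (n + 1)]
    ring
  rw [dist_def, (summable_dist _ _).tsum_eq_zero_add, h]
  simp

theorem dist_cons (a : E) (x y : ShiftSpace E) : dist (cons a x) (cons a y) = dist x y / 2 := by
  simp [dist_cons_cons]

theorem dist_cons_rpow (a : E) (x y : ShiftSpace E) (s : ℝ) :
    dist (cons a x) (cons a y) ^ s = (1 / 2 : ℝ) ^ s * dist x y ^ s := by
  rw [dist_cons, div_eq_inv_mul, Real.mul_rpow (by norm_num) dist_nonneg, one_div]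

theorem dist_le_one (x y : ShiftSpace E) : dist x y ≤ 1 := by
  have h : ∑' n : ℕ, (1 / 2 : ℝ) ^ (n + 1) = 1 := by
    simp_rw [pow_succ]
    rw [tsum_mul_right, tsum_geometric_two]
    norm_num
  exact ((summable_dist x y).tsum_le_tsum
    (fun n => mul_le_of_le_one_right (by positivity) (min_le_right _ _))
    ((summable_nat_add_iff 1).2 summable_geometric_two)).trans_eq h

theorem dist_rpow_mem_Icc (x y : ShiftSpace E) (α : ℝ≥0) :
    dist x y ^ (α : ℝ) ∈ Set.Icc (0 : ℝ) 1 :=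
  ⟨by positivity, Real.rpow_le_one dist_nonneg (dist_le_one x y) α.coe_nonneg⟩

instance : BoundedSpace (ShiftSpace E) :=
  ⟨Metric.isBounded_iff.2 ⟨1, fun x _ y _ => dist_le_one x y⟩⟩

theorem continuous_cons : Continuous fun q : E × ShiftSpace E => cons q.1 q.2 := by
  refine LipschitzWith.continuous (K := 1) (LipschitzWith.of_dist_le_mul fun q q' => ?_)
  rw [dist_cons_cons, Prod.dist_eq, NNReal.coe_one, one_mul]
  linarith [min_le_left (dist q.1 q'.1) 1, le_max_left (dist q.1 q'.1) (dist q.2 q'.2),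
    le_max_right (dist q.1 q'.1) (dist q.2 q'.2)]

theorem continuous_coord (i : ℕ) : Continuous fun x : ShiftSpace E => x i := by
  rw [Metric.continuous_iff]
  intro x ε hε
  refine ⟨(1 / 2) ^ (i + 1) * min ε 1, by positivity, fun y hy => ?_⟩
  have h : (1 / 2 : ℝ) ^ (i + 1) * min (dist (y i) (x i)) 1 ≤ dist y x :=
    (summable_dist y x).le_tsum i fun k _ => by positivity
  have hlt := lt_of_mul_lt_mul_left (h.trans_lt hy) (by positivity)
  by_contra! hle
  exact absurd hlt (not_lt.2 (min_le_min_right 1 hle))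

/-- The identity from `E^ℕ` with the product topology to the metric space `ShiftSpace E`. -/
def ofPi (x : ℕ → E) : ShiftSpace E := x

theorem continuous_ofPi : Continuous (ofPi : (ℕ → E) → ShiftSpace E) := by
  refine continuous_iff_continuousAt.2 fun x => tendsto_iff_dist_tendsto_zero.2 ?_
  have h : Continuous fun y : ℕ → E =>
      ∑' n : ℕ, (1 / 2 : ℝ) ^ (n + 1) * min (dist (y n) (x n)) 1 := by
    refine continuous_tsum (u := fun n => (1 / 2 : ℝ) ^ (n + 1)) (fun n => by fun_prop)
      ((summable_nat_add_iff 1).2 summable_geometric_two) fun n y => ?_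
    rw [Real.norm_of_nonneg (by positivity)]
    exact mul_le_of_le_one_right (by positivity) (min_le_right _ _)
  have h₀ : ∑' n : ℕ, (1 / 2 : ℝ) ^ (n + 1) * min (dist (x n) (x n)) 1 = 0 := by simp
  exact h₀ ▸ h.tendsto x

instance [SecondCountableTopology E] : SecondCountableTopology (ShiftSpace E) :=
  have : TopologicalSpace.SeparableSpace (ShiftSpace E) :=
    (show Function.Surjective ofPi from Function.surjective_id).denseRange.separableSpace
      continuous_ofPi
  UniformSpace.secondCountable_of_separable _

theorem isCompact_pi {K : ℕ → Set E} (hK : ∀ i, IsCompact (K i)) :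
    IsCompact {x : ShiftSpace E | ∀ i, x i ∈ K i} := by
  convert (isCompact_pi_infinite hK).image continuous_ofPi using 1
  exact (Set.image_id' _).symm

end ShiftSpace

/-! ### Contracting moduli and bounded distortion -/

/-- The concave modulus `t ↦ 1 - exp (-A t)`, which is comparable to `t` on `[0, 1]`. Bounding
oscillations by a multiple of it makes the Ruelle operator contract in a single step. -/
def expModulus (A t : ℝ) : ℝ := 1 - Real.exp (-(A * t))

section ExpModulus

variable {A t : ℝ}

theorem expModulus_le_one : expModulus A t ≤ 1 := sub_le_self 1 (Real.exp_pos _).le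

theorem expModulus_pos (hA : 0 < A) (ht : 0 < t) : 0 < expModulus A t :=
  sub_pos.2 (Real.exp_lt_one_iff.2 (neg_lt_zero.2 (mul_pos hA ht)))

theorem expModulus_le_mul : expModulus A t ≤ A * t := by
  linarith [Real.one_sub_le_exp_neg (A * t), expModulus.eq_def A t]

theorem mul_le_expModulus (ht : t ∈ Set.Icc 0 1) : expModulus A 1 * t ≤ expModulus A t := by
  have h := convexOn_exp.2 (Set.mem_univ (-A)) (Set.mem_univ 0) ht.1 (sub_nonneg.2 ht.2) (by ring)
  simp only [smul_eq_mul, mul_zero, add_zero, Real.exp_zero, mul_one] at h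
  rw [show t * -A = -(A * t) by ring] at h
  rw [expModulus, expModulus, mul_one]
  linarith

theorem expModulus_mul_le {b : ℝ} (hA : 0 < A) (hb : b ∈ Set.Icc 0 1) (ht : t ∈ Set.Icc 0 1) :
    expModulus (A * b) t ≤ expModulus (A * b) 1 / expModulus A 1 * expModulus A t := by
  have hpow : ∀ s, expModulus (A * b) s = 1 - Real.exp (-(A * s)) ^ b := fun s => by
    rw [expModulus, ← Real.exp_mul]
    ring_nf
  obtain rfl | ht₀ := ht.1.eq_or_lt
  · simp [expModulus]
  have hlt : Real.exp (-(A * t)) < 1 := Real.exp_lt_one_iff.2 (by nlinarith)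
  have hlt' : Real.exp (-(A * 1)) < 1 := Real.exp_lt_one_iff.2 (by linarith)
  have hle : Real.exp (-(A * 1)) ≤ Real.exp (-(A * t)) := Real.exp_le_exp.2 (by nlinarith [ht.2])
  -- the chords of the concave function `q ↦ q ^ b` that end at `q = 1`
  have hchord := (Real.concaveOn_rpow hb.1 hb.2).neg.secant_mono (Set.mem_Ici.2 zero_le_one)
    (Set.mem_Ici.2 (Real.exp_pos (-(A * 1))).le) (Set.mem_Ici.2 (Real.exp_pos (-(A * t))).le)
    hlt'.ne hlt.ne hle
  simp only [Pi.neg_apply, Real.one_rpow, neg_sub_neg] at hchord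
  rw [← hpow, ← hpow, ← neg_le_neg_iff, ← div_neg, ← div_neg, neg_sub, neg_sub] at hchord
  exact (div_le_iff₀ (expModulus_pos hA ht₀)).1 hchord

theorem exists_contracting_expModulus {K θ : ℝ} (hK : 0 ≤ K) (hθ₀ : 0 ≤ θ) (hθ₁ : θ < 1) :
    ∃ A r : ℝ, 0 < A ∧ 0 < r ∧ r < 1 ∧ ∀ t ∈ Set.Icc (0 : ℝ) 1,
      Real.exp (-(2 * K * t)) * expModulus A (θ * t) + (1 - Real.exp (-(2 * K * t)))
        ≤ r * expModulus A t := by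
  obtain ⟨A, hA⟩ : ∃ A, A = 4 * (K + 1) / (1 - θ) := ⟨_, rfl⟩
  obtain ⟨b, hb⟩ : ∃ b, b = (1 + θ) / 2 := ⟨_, rfl⟩
  have hθ : 0 < 1 - θ := sub_pos.2 hθ₁
  have hA₀ : 0 < A := by rw [hA]; positivity
  have hb₀ : 0 < b := by rw [hb]; positivity
  have hb₁ : b < 1 := by rw [hb]; linarith
  have hAb : 2 * K + A * θ ≤ A * b := by
    have : A * b - A * θ = 2 * (K + 1) := by rw [hA, hb]; field_simp; ring
    linarith
  have hr : expModulus (A * b) 1 < expModulus A 1 :=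
    sub_lt_sub_left (Real.exp_lt_exp.2 (by nlinarith)) 1
  refine ⟨A, expModulus (A * b) 1 / expModulus A 1, hA₀,
    div_pos (expModulus_pos (by positivity) one_pos) (expModulus_pos hA₀ one_pos),
    (div_lt_one (expModulus_pos hA₀ one_pos)).2 hr, fun t ht => ?_⟩
  calc Real.exp (-(2 * K * t)) * expModulus A (θ * t) + (1 - Real.exp (-(2 * K * t)))
      = 1 - Real.exp (-(2 * K * t) + -(A * (θ * t))) := by rw [expModulus, Real.exp_add]; ring
    _ ≤ expModulus (A * b) t :=
        sub_le_sub_left (Real.exp_le_exp.2 (by nlinarith [mul_le_mul_of_nonneg_right hAb ht.1])) 1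
    _ ≤ expModulus (A * b) 1 / expModulus A 1 * expModulus A t :=
        expModulus_mul_le hA₀ ⟨hb₀.le, hb₁.le⟩ ht

end ExpModulus

/-- Oscillations bounded by `B` times the modulus `expModulus A` of `d(x, y) ^ α`. -/
def ExpModulusBound {X : Type*} [Dist X] (α : ℝ≥0) (A B : ℝ) (g : X → ℝ) : Prop :=
  ∀ x y, g x - g y ≤ B * expModulus A (dist x y ^ (α : ℝ))

/-- The positive functions whose logarithm is `α`-Hölder with constant `K`. -/
structure LogHolder {X : Type*} [Dist X] (α : ℝ≥0) (K : ℝ) (w : X → ℝ) : Prop where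
  pos : ∀ x, 0 < w x
  le_exp_mul : ∀ x y, w x ≤ Real.exp (K * dist x y ^ (α : ℝ)) * w y

section LogHolder

variable {X : Type*} {α : ℝ≥0} {K : ℝ} {w : X → ℝ}

theorem LogHolder.const_mul [Dist X] {c : ℝ} (hc : 0 < c) (hw : LogHolder α K w) :
    LogHolder α K (fun x => c * w x) where
  pos x := mul_pos hc (hw.pos x)
  le_exp_mul x y := by
    rw [mul_left_comm]
    exact mul_le_mul_of_nonneg_left (hw.le_exp_mul x y) hc.le

theorem LogHolder.of_tendsto [Dist X] {W : ℕ → X → ℝ} (hW : ∀ n, LogHolder α K (W n))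
    (hlim : ∀ x, Tendsto (fun n => W n x) atTop (𝓝 (w x))) (hw : ∀ x, 0 < w x) :
    LogHolder α K w where
  pos := hw
  le_exp_mul x y :=
    le_of_tendsto_of_tendsto' (hlim x) ((hlim y).const_mul _) fun n => (hW n).le_exp_mul x y

theorem LogHolder.one [PseudoMetricSpace X] (hK : 0 ≤ K) : LogHolder α K (1 : X → ℝ) where
  pos _ := one_pos
  le_exp_mul x y := by
    rw [Pi.one_apply, Pi.one_apply, mul_one, Real.one_le_exp_iff]
    positivity

end LogHolder

open ShiftSpace

section BoundedDistortion

variable {E : Type*} [MetricSpace E] {α : ℝ≥0}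

section ExpModulusBound

variable {A B : ℝ} {g : ShiftSpace E → ℝ}

theorem HolderBound.expModulusBound (hA : 0 < A) (hg : HolderBound α B g) (hB : 0 ≤ B) :
    ExpModulusBound α A (B / expModulus A 1) g := fun x y => by
  have h₁ := expModulus_pos hA one_pos
  calc g x - g y ≤ B * dist x y ^ (α : ℝ) := (le_abs_self _).trans (hg x y)
    _ = B / expModulus A 1 * (expModulus A 1 * dist x y ^ (α : ℝ)) := by field_simp
    _ ≤ B / expModulus A 1 * expModulus A (dist x y ^ (α : ℝ)) :=
        mul_le_mul_of_nonneg_left (mul_le_expModulus (dist_rpow_mem_Icc x y α)) (by positivity)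

theorem ExpModulusBound.holderBound (hg : ExpModulusBound α A B g) (hB : 0 ≤ B) :
    HolderBound α (B * A) g := HolderBound.of_sub_le fun x y => (hg x y).trans <| by
  rw [mul_assoc]
  exact mul_le_mul_of_nonneg_left expModulus_le_mul hB

theorem ExpModulusBound.sub_le (hg : ExpModulusBound α A B g) (hB : 0 ≤ B)
    (x y : ShiftSpace E) : g x - g y ≤ B :=
  (hg x y).trans (mul_le_of_le_one_right hB expModulus_le_one)

end ExpModulusBound

section LogHolder

variable {K : ℝ} {w : ShiftSpace E → ℝ}

theorem LogHolder.le_exp_mul_const (hK : 0 ≤ K) (hw : LogHolder α K w)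
    (x y : ShiftSpace E) : w x ≤ Real.exp K * w y :=
  (hw.le_exp_mul x y).trans <| mul_le_mul_of_nonneg_right
    (Real.exp_le_exp.2 (mul_le_of_le_one_right hK (dist_rpow_mem_Icc x y α).2)) (hw.pos y).le

theorem LogHolder.exists_holderBound (hK : 0 ≤ K) (hw : LogHolder α K w) :
    ∃ B, HolderBound α B w := by
  obtain _ | ⟨⟨x₀⟩⟩ := isEmpty_or_nonempty (ShiftSpace E)
  · exact ⟨0, isEmptyElim⟩
  refine ⟨Real.exp K * w x₀ * (K * Real.exp K), HolderBound.of_sub_le fun x y => ?_⟩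
  set s := K * dist x y ^ (α : ℝ) with hs
  have hs₀ : 0 ≤ s := by positivity
  have hsK : s ≤ K := mul_le_of_le_one_right hK (dist_rpow_mem_Icc x y α).2
  have hexp : Real.exp s - 1 ≤ s * Real.exp K := by
    have h := mul_le_mul_of_nonneg_right (Real.one_sub_le_exp_neg s) (Real.exp_pos s).le
    rw [← Real.exp_add, neg_add_cancel, Real.exp_zero] at h
    linarith [mul_le_mul_of_nonneg_left (Real.exp_le_exp.2 hsK) hs₀]
  calc w x - w y ≤ w y * (Real.exp s - 1) := by linarith [hw.le_exp_mul x y]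
    _ ≤ Real.exp K * w x₀ * (s * Real.exp K) :=
        mul_le_mul (hw.le_exp_mul_const hK y x₀) hexp (sub_nonneg.2 (Real.one_le_exp hs₀))
          (mul_pos (Real.exp_pos K) (hw.pos x₀)).le
    _ = Real.exp K * w x₀ * (K * Real.exp K) * dist x y ^ (α : ℝ) := by rw [hs]; ring

theorem LogHolder.mem_Icc_of_integral_eq_one {ν : Measure (ShiftSpace E)}
    [IsProbabilityMeasure ν] (hK : 0 ≤ K) (hw : LogHolder α K w) (hint : Integrable w ν)
    (h₁ : ∫ x, w x ∂ν = 1) (x : ShiftSpace E) :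
    w x ∈ Set.Icc (Real.exp (-K)) (Real.exp K) := by
  obtain ⟨y, hy⟩ := exists_le_integral hint
  obtain ⟨z, hz⟩ := exists_integral_le hint
  rw [h₁] at hy hz
  constructor
  · rw [Real.exp_neg, inv_le_iff_one_le_mul₀' (Real.exp_pos K)]
    exact hz.trans (hw.le_exp_mul_const hK z x)
  · exact (hw.le_exp_mul_const hK x y).trans (mul_le_of_le_one_right (Real.exp_pos K).le hy)

end LogHolder

/-- The constant `K = D θ / (1 - θ)`, with `D = D_α(f)` and `θ = 2^{-α}`: the fixed point of
`K ↦ (D + K) θ`, which describes how the Ruelle operator of `f` changes the Hölder constant of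
`log w`. -/
def Hol.distortion (f : Hol (ShiftSpace E) α) : ℝ :=
  nnHolderNorm α (f : ShiftSpace E → ℝ) * (1 / 2 : ℝ) ^ (α : ℝ) / (1 - (1 / 2 : ℝ) ^ (α : ℝ))

theorem half_rpow_lt_one (hα : 0 < α) : (1 / 2 : ℝ) ^ (α : ℝ) < 1 :=
  Real.rpow_lt_one (by norm_num) (by norm_num) hα

namespace Hol

variable (f : Hol (ShiftSpace E) α)

theorem distortion_nonneg : 0 ≤ f.distortion :=
  div_nonneg (by positivity)
    (sub_nonneg.2 (Real.rpow_le_one (by norm_num) (by norm_num) α.coe_nonneg))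

theorem add_distortion_mul (hα : 0 < α) :
    (nnHolderNorm α (f : ShiftSpace E → ℝ) + f.distortion) * (1 / 2 : ℝ) ^ (α : ℝ)
      = f.distortion := by
  have h : 1 - (1 / 2 : ℝ) ^ (α : ℝ) ≠ 0 := (sub_pos.2 (half_rpow_lt_one hα)).ne'
  rw [distortion]
  field_simp
  ring

theorem exp_mul_cons_le (hα : 0 < α) {w : ShiftSpace E → ℝ} (hw : LogHolder α f.distortion w)
    (a : E) (x y : ShiftSpace E) :
    Real.exp (f (cons a x)) * w (cons a x)
      ≤ Real.exp (f.distortion * dist x y ^ (α : ℝ))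
        * (Real.exp (f (cons a y)) * w (cons a y)) := by
  set t := dist x y ^ (α : ℝ) with ht
  have hwa := hw.le_exp_mul (cons a x) (cons a y)
  have hfa := (abs_le.1 (f.holderBound (cons a x) (cons a y))).2
  rw [dist_cons_rpow, ← ht] at hwa hfa
  calc Real.exp (f (cons a x)) * w (cons a x)
      ≤ Real.exp (f (cons a x)) *
          (Real.exp (f.distortion * ((1 / 2) ^ (α : ℝ) * t)) * w (cons a y)) :=
        mul_le_mul_of_nonneg_left hwa (Real.exp_pos _).le
    _ = Real.exp (f (cons a x) + f.distortion * ((1 / 2) ^ (α : ℝ) * t)) * w (cons a y) := by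
        rw [Real.exp_add, mul_assoc]
    _ ≤ Real.exp (f.distortion * t + f (cons a y)) * w (cons a y) := by
        refine mul_le_mul_of_nonneg_right (Real.exp_le_exp.2 ?_) (hw.pos _).le
        linarith [congrArg (· * t) (f.add_distortion_mul hα)]
    _ = _ := by rw [Real.exp_add, mul_assoc]

end Hol

end BoundedDistortion

/-! ### The Ruelle operator on bounded continuous functions -/

section RuelleOperator

theorem abs_exp_mul_le {E : Type*} [MetricSpace E] (f φ : ShiftSpace E →ᵇ ℝ) (x : ShiftSpace E) :
    |Real.exp (f x) * φ x| ≤ Real.exp ‖f‖ * ‖φ‖ := by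
  rw [abs_mul, Real.abs_exp]
  exact mul_le_mul (Real.exp_le_exp.2 ((le_abs_self _).trans (f.norm_coe_le_norm x)))
    (φ.norm_coe_le_norm x) (abs_nonneg _) (Real.exp_pos _).le

variable {E : Type*} [MetricSpace E] [MeasurableSpace E] [OpensMeasurableSpace E]
  (p : Measure E) [IsProbabilityMeasure p] (f : ShiftSpace E →ᵇ ℝ)

theorem integrable_exp_mul_cons (φ : ShiftSpace E →ᵇ ℝ) (x : ShiftSpace E) :
    Integrable (fun a => Real.exp (f (cons a x)) * φ (cons a x)) p := by
  have hcons : Continuous fun a => cons a x := continuous_cons.comp (.prodMk_left x)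
  exact .of_bound ((f.continuous.comp hcons).rexp.mul
    (φ.continuous.comp hcons)).aestronglyMeasurable (Real.exp ‖f‖ * ‖φ‖)
    (ae_of_all _ fun a => abs_exp_mul_le f φ (cons a x))

theorem continuous_ruelle (φ : ShiftSpace E →ᵇ ℝ) : Continuous (ruelle p f φ) :=
  continuous_of_dominated (fun x => (integrable_exp_mul_cons p f φ x).aestronglyMeasurable)
    (fun x => ae_of_all _ fun a => abs_exp_mul_le f φ (cons a x)) (integrable_const _)
    (ae_of_all _ fun a => by
      have hcons : Continuous (cons a) := continuous_cons.comp (.prodMk_right a)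
      exact (f.continuous.comp hcons).rexp.mul (φ.continuous.comp hcons))

omit [OpensMeasurableSpace E] in
theorem abs_ruelle_le (φ : ShiftSpace E →ᵇ ℝ) (x : ShiftSpace E) :
    |ruelle p f φ x| ≤ Real.exp ‖f‖ * ‖φ‖ := by
  have h := norm_integral_le_of_norm_le_const (μ := p)
    (f := fun a => Real.exp (f (cons a x)) * φ (cons a x))
    (ae_of_all _ fun a => abs_exp_mul_le f φ (cons a x))
  rwa [probReal_univ, mul_one] at h

/-- The Ruelle operator as a bounded operator on the bounded continuous functions. -/
def ruelleCLM : (ShiftSpace E →ᵇ ℝ) →L[ℝ] (ShiftSpace E →ᵇ ℝ) :=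
  LinearMap.mkContinuous
    { toFun := fun φ => BoundedContinuousFunction.ofNormedAddCommGroup (ruelle p f φ)
        (continuous_ruelle p f φ) (Real.exp ‖f‖ * ‖φ‖) (abs_ruelle_le p f φ)
      map_add' := fun φ ψ => by
        ext x
        have h := integral_add (integrable_exp_mul_cons p f φ x) (integrable_exp_mul_cons p f ψ x)
        simp only [← mul_add] at h
        exact h
      map_smul' := fun c φ => by
        ext x
        have h := integral_const_mul (μ := p) c fun a => Real.exp (f (cons a x)) * φ (cons a x)
        simp only [mul_left_comm c] at h
        exact h }
    (Real.exp ‖f‖) fun φ =>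
      (BoundedContinuousFunction.norm_le (by positivity)).2 (abs_ruelle_le p f φ)

theorem ruelleCLM_apply (φ : ShiftSpace E →ᵇ ℝ) (x : ShiftSpace E) :
    ruelleCLM p f φ x = ∫ a, Real.exp (f (cons a x)) * φ (cons a x) ∂p := rfl

theorem ruelleCLM_pow_succ_apply (n : ℕ) (φ : ShiftSpace E →ᵇ ℝ) :
    (ruelleCLM p f ^ (n + 1)) φ = ruelleCLM p f ((ruelleCLM p f ^ n) φ) := by
  rw [pow_succ']; rfl

theorem iterate_ruelle (n : ℕ) (φ : ShiftSpace E →ᵇ ℝ) :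
    (ruelle p f)^[n] φ = (ruelleCLM p f ^ n) φ := by
  induction n with
  | zero => rfl
  | succ n ih => rw [Function.iterate_succ_apply', ih, ruelleCLM_pow_succ_apply]; rfl

variable {p f}

theorem ruelleCLM_le_mul {φ ψ : ShiftSpace E →ᵇ ℝ} {x y : ShiftSpace E} {c : ℝ}
    (h : ∀ a, Real.exp (f (cons a x)) * φ (cons a x)
      ≤ c * (Real.exp (f (cons a y)) * ψ (cons a y))) :
    ruelleCLM p f φ x ≤ c * ruelleCLM p f ψ y := by
  rw [ruelleCLM_apply, ruelleCLM_apply, ← integral_const_mul]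
  exact integral_mono (integrable_exp_mul_cons p f φ x)
    ((integrable_exp_mul_cons p f ψ y).const_mul c) h

theorem ruelleCLM_mono {φ ψ : ShiftSpace E →ᵇ ℝ} (h : ∀ x, φ x ≤ ψ x) (x : ShiftSpace E) :
    ruelleCLM p f φ x ≤ ruelleCLM p f ψ x := by
  simpa only [one_mul] using ruelleCLM_le_mul (c := 1) (x := x) (y := x) fun a => by
    simpa only [one_mul] using mul_le_mul_of_nonneg_left (h _) (Real.exp_pos _).le

theorem ruelleCLM_pos {w : ShiftSpace E →ᵇ ℝ} (hw : ∀ x, 0 < w x) (x : ShiftSpace E) :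
    0 < ruelleCLM p f w x := by
  obtain ⟨a, ha⟩ := exists_le_integral (integrable_exp_mul_cons p f w x)
  exact (mul_pos (Real.exp_pos _) (hw _)).trans_le ha

theorem mul_ruelleCLM_le {v w : ShiftSpace E →ᵇ ℝ} {s : ℝ} (h : ∀ x, s * w x ≤ v x)
    (x : ShiftSpace E) : s * ruelleCLM p f w x ≤ ruelleCLM p f v x := by
  simpa using ruelleCLM_mono (p := p) (f := f) (φ := s • w) h x

theorem ruelleCLM_pow_pos {w : ShiftSpace E →ᵇ ℝ} (hw : ∀ x, 0 < w x) (n : ℕ) :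
    ∀ x, 0 < (ruelleCLM p f ^ n) w x := by
  induction n with
  | zero => exact hw
  | succ n ih => simpa only [ruelleCLM_pow_succ_apply] using ruelleCLM_pos ih

theorem mul_ruelleCLM_pow_le {v w : ShiftSpace E →ᵇ ℝ} {s : ℝ} (h : ∀ x, s * w x ≤ v x) (n : ℕ) :
    ∀ x, s * (ruelleCLM p f ^ n) w x ≤ (ruelleCLM p f ^ n) v x := by
  induction n with
  | zero => exact h
  | succ n ih => simpa only [ruelleCLM_pow_succ_apply] using mul_ruelleCLM_le ih

end RuelleOperator

/-! ### Contraction of the oscillation of ratios -/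

section Contraction

variable {E : Type*} [MetricSpace E] [MeasurableSpace E] [OpensMeasurableSpace E] {p : Measure E}
  [IsProbabilityMeasure p] {α : ℝ≥0} {f : Hol (ShiftSpace E) α} {v w : ShiftSpace E →ᵇ ℝ}

theorem LogHolder.ruelle (hα : 0 < α) (hw : LogHolder α f.distortion w) :
    LogHolder α f.distortion (ruelleCLM p f.toBCF w) where
  pos := ruelleCLM_pos hw.pos
  le_exp_mul x y := ruelleCLM_le_mul fun a => f.exp_mul_cons_le hα hw a x y

theorem LogHolder.ruelle_pow (hα : 0 < α) (hw : LogHolder α f.distortion w) (n : ℕ) :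
    LogHolder α f.distortion ((ruelleCLM p f.toBCF ^ n) w) := by
  induction n with
  | zero => exact hw
  | succ n ih => simpa only [ruelleCLM_pow_succ_apply] using ih.ruelle hα

theorem mul_ruelleCLM_sub_le (hα : 0 < α) (hw : LogHolder α f.distortion w)
    {x y : ShiftSpace E} {k l : ℝ} (hl : ∀ z, v z / w z ≤ l)
    (hkl : ∀ a, v (cons a x) / w (cons a x) - v (cons a y) / w (cons a y) ≤ l - k) :
    k * ruelleCLM p f.toBCF w y - ruelleCLM p f.toBCF v y
      ≤ Real.exp (f.distortion * dist x y ^ (α : ℝ))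
        * (l * ruelleCLM p f.toBCF w x - ruelleCLM p f.toBCF v x) := by
  have hfactor : ∀ c z, (c • w - v) z = w z * (c - v z / w z) := fun c z => by
    rw [mul_sub, mul_div_cancel₀ _ (hw.pos z).ne', mul_comm]; rfl
  have hfibre : ∀ a, Real.exp (f (cons a y)) * (k • w - v) (cons a y)
      ≤ Real.exp (f.distortion * dist x y ^ (α : ℝ))
        * (Real.exp (f (cons a x)) * (l • w - v) (cons a x)) := fun a => by
    have hcmp := f.exp_mul_cons_le hα hw a y x
    rw [dist_comm] at hcmp
    rw [hfactor, hfactor, ← mul_assoc, ← mul_assoc, ← mul_assoc, mul_assoc (Real.exp (_ * _))]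
    exact (mul_le_mul_of_nonneg_left (by linarith [hkl a])
      (mul_pos (Real.exp_pos _) (hw.pos _)).le).trans
      (mul_le_mul_of_nonneg_right hcmp (sub_nonneg.2 (hl _)))
  simpa using ruelleCLM_le_mul (p := p) hfibre

/-- The coupling estimate: the fibres over `x` and `y` share the proportion `exp (-2Kt)` of their
mass, on which the ratio `v / w` varies by at most `δ`, and on the rest by at most `R`. -/
theorem ruelleCLM_div_sub_le (hα : 0 < α) (hw : LogHolder α f.distortion w) {x y : ShiftSpace E}
    {δ R : ℝ} (hδR : δ ≤ R) (hR : ∀ z z', v z / w z - v z' / w z' ≤ R)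
    (hδ : ∀ a, v (cons a x) / w (cons a x) - v (cons a y) / w (cons a y) ≤ δ) :
    ruelleCLM p f.toBCF v x / ruelleCLM p f.toBCF w x
        - ruelleCLM p f.toBCF v y / ruelleCLM p f.toBCF w y
      ≤ Real.exp (-(2 * f.distortion * dist x y ^ (α : ℝ))) * δ
        + (1 - Real.exp (-(2 * f.distortion * dist x y ^ (α : ℝ)))) * R := by
  rw [mul_assoc 2]
  set s := f.distortion * dist x y ^ (α : ℝ)
  set c := ruelleCLM p f.toBCF v y / ruelleCLM p f.toBCF w y
  have hwx := ruelleCLM_pos (p := p) (f := f.toBCF) hw.pos x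
  have hwy := ruelleCLM_pos (p := p) (f := f.toBCF) hw.pos y
  have hle : ∀ z, v z / w z ≤ R + c := fun z => by
    have h : v z / w z - R ≤ c := (le_div_iff₀ hwy).2 <| mul_ruelleCLM_le (fun z' =>
      (le_div_iff₀ (hw.pos z')).1 (by linarith [hR z z'])) y
    linarith
  have hcoupled := mul_ruelleCLM_sub_le (p := p) (k := R + c - δ) hα hw hle
    fun a => (hδ a).trans_eq (sub_sub_cancel _ _).symm
  have hvy : ruelleCLM p f.toBCF v y = c * ruelleCLM p f.toBCF w y :=
    (div_mul_cancel₀ _ hwy.ne').symm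
  have hkey : R - δ ≤ Real.exp s * Real.exp s *
      (R + c - ruelleCLM p f.toBCF v x / ruelleCLM p f.toBCF w x) := by
    refine le_of_mul_le_mul_right ?_ hwx
    calc (R - δ) * ruelleCLM p f.toBCF w x
        ≤ (R - δ) * (Real.exp s * ruelleCLM p f.toBCF w y) :=
          mul_le_mul_of_nonneg_left ((hw.ruelle hα).le_exp_mul x y) (sub_nonneg.2 hδR)
      _ = Real.exp s * ((R + c - δ) * ruelleCLM p f.toBCF w y - ruelleCLM p f.toBCF v y) := by
          rw [hvy]; ring
      _ ≤ Real.exp s * (Real.exp s *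
            ((R + c) * ruelleCLM p f.toBCF w x - ruelleCLM p f.toBCF v x)) :=
          mul_le_mul_of_nonneg_left hcoupled (Real.exp_pos s).le
      _ = _ := by field_simp
  have hscaled : Real.exp (-(2 * s)) * (R - δ)
      ≤ R + c - ruelleCLM p f.toBCF v x / ruelleCLM p f.toBCF w x := by
    rwa [Real.exp_neg, inv_mul_le_iff₀ (Real.exp_pos _), two_mul, Real.exp_add]
  linarith

theorem exists_ruelleCLM_contraction (p : Measure E) [IsProbabilityMeasure p] (hα : 0 < α)
    (f : Hol (ShiftSpace E) α) :
    ∃ A r : ℝ, 0 < A ∧ 0 < r ∧ r < 1 ∧ ∀ (w v : ShiftSpace E →ᵇ ℝ) (B : ℝ),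
      LogHolder α f.distortion w → 0 ≤ B → ExpModulusBound α A B (fun x => v x / w x) →
      ExpModulusBound α A (r * B)
        (fun x => ruelleCLM p f.toBCF v x / ruelleCLM p f.toBCF w x) := by
  obtain ⟨A, r, hA, hr₀, hr₁, hcontr⟩ := exists_contracting_expModulus f.distortion_nonneg
    (by positivity) (half_rpow_lt_one hα)
  refine ⟨A, r, hA, hr₀, hr₁, fun w v B hw hB hvw x y => ?_⟩
  have hstep := ruelleCLM_div_sub_le (p := p) (v := v) (x := x) (y := y) hα hw
    (mul_le_of_le_one_right hB expModulus_le_one) (fun z z' => hvw.sub_le hB z z')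
    fun a => dist_cons_rpow a x y α ▸ hvw (cons a x) (cons a y)
  refine hstep.trans ?_
  linarith [mul_le_mul_of_nonneg_left (hcontr _ (dist_rpow_mem_Icc x y α)) hB]

theorem exists_holderBound_ruelleCLM_pow_div (p : Measure E) [IsProbabilityMeasure p]
    (hα : 0 < α) (f : Hol (ShiftSpace E) α) :
    ∃ C r : ℝ, 0 < C ∧ 0 < r ∧ r < 1 ∧ ∀ (w v : ShiftSpace E →ᵇ ℝ) (B : ℝ),
      LogHolder α f.distortion w → 0 ≤ B → HolderBound α B (fun x => v x / w x) →
      ∀ n : ℕ, HolderBound α (C * r ^ n * B)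
        (fun x => (ruelleCLM p f.toBCF ^ n) v x / (ruelleCLM p f.toBCF ^ n) w x) := by
  obtain ⟨A, r, hA, hr₀, hr₁, hcontr⟩ := exists_ruelleCLM_contraction p hα f
  have h₁ := expModulus_pos hA one_pos
  refine ⟨A / expModulus A 1, r, by positivity, hr₀, hr₁, fun w v B hw hB hvw n => ?_⟩
  have hiter : ExpModulusBound α A (r ^ n * (B / expModulus A 1))
      (fun x => (ruelleCLM p f.toBCF ^ n) v x / (ruelleCLM p f.toBCF ^ n) w x) := by
    induction n with
    | zero => simpa using hvw.expModulusBound hA hB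
    | succ n ih =>
      simp only [ruelleCLM_pow_succ_apply, pow_succ' r, mul_assoc]
      exact hcontr _ _ _ (hw.ruelle_pow hα n) (by positivity) ih
  exact (hiter.holderBound (by positivity)).mono (by rw [div_mul_eq_mul_div]; field_simp; rfl)

end Contraction

/-! ### The normalized eigenfunction of a conformal measure -/

section Conformal

variable {E : Type*} [MetricSpace E] [MeasurableSpace E]

/-- The equation `L_f^* ν = lam ν`, tested on bounded continuous functions. -/
structure IsConformal (p : Measure E) (f : ShiftSpace E → ℝ) (ν : Measure (ShiftSpace E))
    (lam : ℝ) : Prop where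
  lam_pos : 0 < lam
  integral_ruelle : ∀ φ : ShiftSpace E →ᵇ ℝ, ∫ x, ruelle p f φ x ∂ν = lam * ∫ x, φ x ∂ν

theorem IsPFRData.isConformal {p : Measure E} {f h : ShiftSpace E → ℝ}
    {ν : Measure (ShiftSpace E)} {lam : ℝ} (hν : IsPFRData p f ν lam h) :
    IsConformal p f ν lam :=
  ⟨hν.lam_pos, hν.conformal⟩

/-- A positive eigenfunction of the Ruelle operator with controlled distortion, normalized with
respect to a conformal measure with the same eigenvalue. -/
structure IsNormalizedEigenfunction {α : ℝ≥0} (p : Measure E) (f : Hol (ShiftSpace E) α)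
    (ν : Measure (ShiftSpace E)) (lam : ℝ) (H : Hol (ShiftSpace E) α) : Prop
    extends IsConformal p f ν lam where
  logHolder : LogHolder α f.distortion H
  ruelle_eq : ∀ x, ruelle p f H x = lam * H x
  integral_eq_one : ∫ x, H x ∂ν = 1

variable [OpensMeasurableSpace E] {p : Measure E} [IsProbabilityMeasure p]
  {ν : Measure (ShiftSpace E)} {lam : ℝ}

theorem IsConformal.integral_ruelleCLM_pow {f : ShiftSpace E →ᵇ ℝ} (hν : IsConformal p f ν lam)
    (n : ℕ) (φ : ShiftSpace E →ᵇ ℝ) :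
    ∫ x, (ruelleCLM p f ^ n) φ x ∂ν = lam ^ n * ∫ x, φ x ∂ν := by
  induction n with
  | zero => simp
  | succ n ih =>
    calc ∫ x, (ruelleCLM p f ^ (n + 1)) φ x ∂ν
        = ∫ x, ruelle p f ((ruelleCLM p f ^ n) φ) x ∂ν := by
          rw [ruelleCLM_pow_succ_apply]; rfl
      _ = lam ^ (n + 1) * ∫ x, φ x ∂ν := by rw [hν.integral_ruelle, ih, pow_succ', mul_assoc]

variable {α : ℝ≥0} {f : Hol (ShiftSpace E) α}

/-- The functions `lam⁻ⁿ L_f^n 1`, whose limit is the eigenfunction. -/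
def normalizedIterate (p : Measure E) [IsProbabilityMeasure p] (f : Hol (ShiftSpace E) α)
    (lam : ℝ) (n : ℕ) : ShiftSpace E →ᵇ ℝ :=
  (lam ^ n)⁻¹ • (ruelleCLM p f.toBCF ^ n) 1

theorem normalizedIterate_apply (n : ℕ) (x : ShiftSpace E) :
    normalizedIterate p f lam n x = (lam ^ n)⁻¹ * (ruelleCLM p f.toBCF ^ n) 1 x := rfl

theorem ruelleCLM_normalizedIterate (hlam : lam ≠ 0) (n : ℕ) :
    ruelleCLM p f.toBCF (normalizedIterate p f lam n)
      = lam • normalizedIterate p f lam (n + 1) := by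
  rw [normalizedIterate, normalizedIterate, map_smul, ruelleCLM_pow_succ_apply, smul_smul,
    pow_succ', mul_inv, mul_inv_cancel_left₀ hlam]

namespace IsConformal

theorem logHolder_normalizedIterate (hν : IsConformal p f ν lam) (hα : 0 < α) (n : ℕ) :
    LogHolder α f.distortion (normalizedIterate p f lam n) :=
  ((LogHolder.one f.distortion_nonneg).ruelle_pow (w := 1) hα n).const_mul
    (inv_pos.2 (pow_pos hν.lam_pos n))

variable [IsProbabilityMeasure ν]

theorem integral_normalizedIterate (hν : IsConformal p f ν lam) (n : ℕ) :
    ∫ x, normalizedIterate p f lam n x ∂ν = 1 := by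
  simp_rw [normalizedIterate_apply]
  rw [integral_const_mul, hν.integral_ruelleCLM_pow]
  simp [hν.lam_pos.ne']

theorem normalizedIterate_mem_Icc (hν : IsConformal p f ν lam) (hα : 0 < α) (n : ℕ)
    (x : ShiftSpace E) :
    normalizedIterate p f lam n x ∈ Set.Icc (Real.exp (-f.distortion)) (Real.exp f.distortion) :=
  (hν.logHolder_normalizedIterate hα n).mem_Icc_of_integral_eq_one f.distortion_nonneg
    (BoundedContinuousFunction.integrable ν _) (hν.integral_normalizedIterate n) x

theorem exists_abs_ruelleCLM_pow_div_sub_le (hν : IsConformal p f ν lam) (hα : 0 < α) :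
    ∃ C r : ℝ, r < 1 ∧ ∀ (n : ℕ) (x : ShiftSpace E),
      |(ruelleCLM p f.toBCF ^ (n + 1)) 1 x / (ruelleCLM p f.toBCF ^ n) 1 x - lam| ≤ C * r ^ n := by
  obtain ⟨C, r, hC, hr₀, hr₁, hcontr⟩ := exists_holderBound_ruelleCLM_pow_div p hα f
  have hone : LogHolder α f.distortion (1 : ShiftSpace E →ᵇ ℝ) := .one f.distortion_nonneg
  obtain ⟨B, hB⟩ := (hone.ruelle (p := p) hα).exists_holderBound f.distortion_nonneg
  refine ⟨C * |B|, r, hr₁, fun n x => ?_⟩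
  have hpos := ruelleCLM_pow_pos (p := p) (f := f.toBCF) hone.pos n
  have hratio := hcontr 1 (ruelleCLM p f.toBCF 1) |B| hone (abs_nonneg B)
    (by simpa using hB.mono (le_abs_self B)) n
  have hsucc : (ruelleCLM p f.toBCF ^ n) (ruelleCLM p f.toBCF 1)
      = (ruelleCLM p f.toBCF ^ (n + 1)) 1 := by rw [pow_succ]; rfl
  rw [hsucc] at hratio
  have hmul : ∀ y, ((ruelleCLM p f.toBCF ^ (n + 1)) 1 y / (ruelleCLM p f.toBCF ^ n) 1 y - lam)
      * (ruelleCLM p f.toBCF ^ n) 1 y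
      = (ruelleCLM p f.toBCF ^ (n + 1)) 1 y - lam * (ruelleCLM p f.toBCF ^ n) 1 y := fun y => by
    rw [sub_mul, div_mul_cancel₀ _ (hpos y).ne']
  have hint := ((ruelleCLM p f.toBCF ^ (n + 1)) 1).integrable ν
  have hint' := (((ruelleCLM p f.toBCF ^ n) 1).integrable ν).const_mul lam
  refine abs_sub_le_of_integral_sub_mul_eq_zero (ν := ν) hpos ?_ ?_
    (fun y z => (hratio y z).trans ?_) x
  · simp only [hmul]
    exact hint.sub hint'
  · simp_rw [hmul]
    rw [integral_sub hint hint', integral_const_mul, hν.integral_ruelleCLM_pow,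
      hν.integral_ruelleCLM_pow, pow_succ']
    ring
  · rw [mul_right_comm C]
    exact mul_le_of_le_one_right (by positivity) (dist_rpow_mem_Icc y z α).2

theorem cauchySeq_normalizedIterate (hν : IsConformal p f ν lam) (hα : 0 < α) :
    CauchySeq (normalizedIterate p f lam) := by
  obtain ⟨C, r, hr₁, hC⟩ := hν.exists_abs_ruelleCLM_pow_div_sub_le hα
  refine cauchySeq_of_le_geometric r (Real.exp f.distortion * (lam⁻¹ * C)) hr₁ fun n => ?_
  have hlam := hν.lam_pos
  have hr : 0 ≤ C * r ^ n := by
    obtain ⟨x⟩ := ν.nonempty_of_neZero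
    exact (abs_nonneg _).trans (hC n x)
  rw [mul_assoc, mul_assoc, dist_comm, BoundedContinuousFunction.dist_le (by positivity)]
  intro x
  have hpos := ruelleCLM_pow_pos (p := p) (f := f.toBCF) (w := 1) (fun _ => one_pos) n x
  have hbound := hν.normalizedIterate_mem_Icc hα n x
  calc dist (normalizedIterate p f lam (n + 1) x) (normalizedIterate p f lam n x)
      = |normalizedIterate p f lam n x * (lam⁻¹ *
          ((ruelleCLM p f.toBCF ^ (n + 1)) 1 x / (ruelleCLM p f.toBCF ^ n) 1 x - lam))| := by
        rw [Real.dist_eq, normalizedIterate_apply, normalizedIterate_apply, pow_succ lam]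
        field_simp
    _ ≤ Real.exp f.distortion * (lam⁻¹ * (C * r ^ n)) := by
        rw [abs_mul, abs_mul, abs_of_pos (inv_pos.2 hlam),
          abs_of_pos ((Real.exp_pos _).trans_le hbound.1)]
        gcongr
        exacts [hbound.2, hC n x]

theorem exists_isNormalizedEigenfunction (hν : IsConformal p f ν lam) (hα : 0 < α) :
    ∃ H : Hol (ShiftSpace E) α, IsNormalizedEigenfunction p f ν lam H ∧
      ∀ x, Tendsto (fun n => normalizedIterate p f lam n x) atTop (𝓝 (H x)) := by
  obtain ⟨G, hG⟩ := cauchySeq_tendsto_of_complete (hν.cauchySeq_normalizedIterate hα)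
  have hlim : ∀ x, Tendsto (fun n => normalizedIterate p f lam n x) atTop (𝓝 (G x)) := fun x =>
    (BoundedContinuousFunction.tendsto_iff_tendstoUniformly.1 hG).tendsto_at x
  have hmem := hν.normalizedIterate_mem_Icc hα
  have hlog : LogHolder α f.distortion G :=
    .of_tendsto (hν.logHolder_normalizedIterate hα) hlim fun x =>
      (Real.exp_pos _).trans_le (ge_of_tendsto' (hlim x) fun n => (hmem n x).1)
  have heigen : ruelleCLM p f.toBCF G = lam • G :=
    tendsto_nhds_unique (((ruelleCLM p f.toBCF).continuous.tendsto G).comp hG) <| by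
      simpa only [Function.comp_def, ruelleCLM_normalizedIterate hν.lam_pos.ne'] using
        ((tendsto_add_atTop_iff_nat 1).2 hG).const_smul lam
  have hint : ∫ x, G x ∂ν = 1 := by
    refine tendsto_nhds_unique (tendsto_integral_of_dominated_convergence
      (fun _ => Real.exp f.distortion) (fun n => (BoundedContinuousFunction.integrable ν
      (normalizedIterate p f lam n)).aestronglyMeasurable) (integrable_const _)
      (fun n => ae_of_all _ fun x => ?_) (ae_of_all _ hlim)) ?_
    · rw [Real.norm_of_nonneg ((Real.exp_pos _).le.trans (hmem n x).1)]
      exact (hmem n x).2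
    · simp only [hν.integral_normalizedIterate, tendsto_const_nhds]
  exact ⟨Hol.ofHolderBound hα G (hlog.exists_holderBound f.distortion_nonneg),
    ⟨hν, hlog, fun x => DFunLike.congr_fun heigen x, hint⟩, hlim⟩

theorem iterate_ruelle_one_div_integral (hν : IsConformal p f ν lam) (n : ℕ)
    (x : ShiftSpace E) : (ruelle p f)^[n] 1 x / ∫ y, (ruelle p f)^[n] 1 y ∂ν
      = normalizedIterate p f lam n x := by
  have hone : (ruelle p f)^[n] 1 = (ruelleCLM p f.toBCF ^ n) 1 := iterate_ruelle p f.toBCF n 1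
  rw [hone, hν.integral_ruelleCLM_pow, normalizedIterate_apply, div_eq_inv_mul]
  simp

theorem exists_isPFRData (hν : IsConformal p f ν lam) (hα : 0 < α) :
    ∃ h, IsPFRData p f ν lam h := by
  obtain ⟨H, -, hlim⟩ := hν.exists_isNormalizedEigenfunction hα
  exact ⟨H, inferInstance, hν.lam_pos, hν.integral_ruelle, fun x => by
    simpa only [hν.iterate_ruelle_one_div_integral] using hlim x⟩

end IsConformal

theorem IsPFRData.exists_isNormalizedEigenfunction {h : ShiftSpace E → ℝ}
    (hν : IsPFRData p f ν lam h) (hα : 0 < α) :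
    ∃ H : Hol (ShiftSpace E) α, IsNormalizedEigenfunction p f ν lam H ∧ ∀ x, H x = h x := by
  have := hν.isProbabilityMeasure
  obtain ⟨H, hH, hlim⟩ := hν.isConformal.exists_isNormalizedEigenfunction hα
  refine ⟨H, hH, fun x => tendsto_nhds_unique (hlim x) ?_⟩
  simpa only [hν.isConformal.iterate_ruelle_one_div_integral] using hν.tendsto_h x

end Conformal

/-! ### Existence of a conformal measure -/

theorem integral_pos_of_forall_pos {X : Type*} [TopologicalSpace X] [MeasurableSpace X]
    [OpensMeasurableSpace X] (μ : Measure X) [IsProbabilityMeasure μ] {φ : X →ᵇ ℝ}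
    (hφ : ∀ x, 0 < φ x) : 0 < ∫ x, φ x ∂μ := by
  obtain ⟨x, hx⟩ := exists_le_integral (φ.integrable μ)
  exact (hφ x).trans_le hx

section NormalizedDual

variable {E : Type*} [MetricSpace E] [MeasurableSpace E] [BorelSpace E]

section Integral

variable [SecondCountableTopology E] (p : Measure E) [IsProbabilityMeasure p]
  (f : ShiftSpace E →ᵇ ℝ) (μ : Measure (ShiftSpace E)) [IsProbabilityMeasure μ]

theorem integrable_prod_exp_mul_cons (φ : ShiftSpace E →ᵇ ℝ) :
    Integrable (fun q => Real.exp (f (cons q.1 q.2)) * φ (cons q.1 q.2)) (p.prod μ) :=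
  .of_bound ((f.continuous.comp continuous_cons).rexp.mul
    (φ.continuous.comp continuous_cons)).aestronglyMeasurable
    (Real.exp ‖f‖ * ‖φ‖) (ae_of_all _ fun q => abs_exp_mul_le f φ (cons q.1 q.2))

theorem integral_prod_exp_mul_cons (φ : ShiftSpace E →ᵇ ℝ) :
    ∫ q, Real.exp (f (cons q.1 q.2)) * φ (cons q.1 q.2) ∂(p.prod μ)
      = ∫ x, ruelleCLM p f φ x ∂μ :=
  integral_prod_symm _ (integrable_prod_exp_mul_cons p f μ φ)

theorem integrable_prod_exp_cons :
    Integrable (fun q => Real.exp (f (cons q.1 q.2))) (p.prod μ) := by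
  simpa using integrable_prod_exp_mul_cons p f μ 1

theorem integral_prod_exp_cons :
    ∫ q, Real.exp (f (cons q.1 q.2)) ∂(p.prod μ) = ∫ x, ruelleCLM p f 1 x ∂μ := by
  simpa using integral_prod_exp_mul_cons p f μ 1

theorem exp_neg_norm_le_integral_prod :
    Real.exp (-‖f‖) ≤ ∫ q, Real.exp (f (cons q.1 q.2)) ∂(p.prod μ) := by
  simpa using integral_mono (integrable_const (Real.exp (-‖f‖)))
    (integrable_prod_exp_cons p f μ) fun q =>
      Real.exp_le_exp.2 (neg_le_of_abs_le (f.norm_coe_le_norm (cons q.1 q.2)))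

end Integral

variable [SecondCountableTopology E] (p : Measure E) [IsProbabilityMeasure p]
  (f : ShiftSpace E →ᵇ ℝ) (μ : ProbabilityMeasure (ShiftSpace E))

/-- The normalized dual Ruelle operator `μ ↦ L_f^* μ / (L_f^* μ)(X)`, whose fixed points are the
conformal probability measures. -/
def normalizedDual : ProbabilityMeasure (ShiftSpace E) :=
  ⟨((p.prod μ).tilted fun q => f (cons q.1 q.2)).map fun q => cons q.1 q.2,
    have := isProbabilityMeasure_tilted (integrable_prod_exp_cons p f μ)
    Measure.isProbabilityMeasure_map continuous_cons.measurable.aemeasurable⟩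

theorem integral_normalizedDual (φ : ShiftSpace E →ᵇ ℝ) :
    ∫ x, φ x ∂(normalizedDual p f μ : Measure (ShiftSpace E))
      = (∫ x, ruelleCLM p f φ x ∂(μ : Measure (ShiftSpace E)))
        / ∫ x, ruelleCLM p f 1 x ∂(μ : Measure (ShiftSpace E)) := by
  rw [normalizedDual, ProbabilityMeasure.coe_mk,
    integral_map continuous_cons.measurable.aemeasurable φ.continuous.aestronglyMeasurable,
    integral_tilted]
  simp only [smul_eq_mul, div_mul_eq_mul_div]
  rw [integral_div, integral_prod_exp_mul_cons, integral_prod_exp_cons]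

theorem continuous_normalizedDual : Continuous (normalizedDual p f) := by
  refine continuous_iff_continuousAt.2 fun μ =>
    ProbabilityMeasure.tendsto_iff_forall_integral_tendsto.2 fun φ => ?_
  simp only [integral_normalizedDual]
  have h := ProbabilityMeasure.tendsto_iff_forall_integral_tendsto.1 (tendsto_id (x := 𝓝 μ))
  exact (h _).div (h _)
    (integral_pos_of_forall_pos (μ : Measure (ShiftSpace E)) (ruelleCLM_pos fun _ => one_pos)).ne'

theorem integral_iterate_normalizedDual (n : ℕ) (φ : ShiftSpace E →ᵇ ℝ) :
    ∫ x, φ x ∂((normalizedDual p f)^[n] μ : Measure (ShiftSpace E))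
      = (∫ x, (ruelleCLM p f ^ n) φ x ∂(μ : Measure (ShiftSpace E)))
        / ∫ x, (ruelleCLM p f ^ n) 1 x ∂(μ : Measure (ShiftSpace E)) := by
  induction n generalizing μ with
  | zero => simp
  | succ n ih =>
    rw [Function.iterate_succ_apply, ih, integral_normalizedDual, integral_normalizedDual,
      div_div_div_cancel_right₀ (integral_pos_of_forall_pos (μ : Measure (ShiftSpace E))
        (ruelleCLM_pos fun _ => one_pos)).ne']
    simp only [ruelleCLM_pow_succ_apply]

theorem isConformal_of_normalizedDual_eq_self (hμ : normalizedDual p f μ = μ) :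
    IsConformal p f μ (∫ x, ruelleCLM p f 1 x ∂(μ : Measure (ShiftSpace E))) := by
  have hpos := integral_pos_of_forall_pos (μ : Measure (ShiftSpace E))
    (ruelleCLM_pos (p := p) (f := f) (w := 1) fun _ => one_pos)
  refine ⟨hpos, fun φ => ?_⟩
  have h := integral_normalizedDual p f μ φ
  rw [hμ, eq_div_iff hpos.ne'] at h
  rw [mul_comm, h]
  rfl

theorem normalizedDual_apply_le {S : Set (ShiftSpace E)} (hS : MeasurableSet S) :
    (normalizedDual p f μ : Measure (ShiftSpace E)) S ≤ ENNReal.ofReal (Real.exp (2 * ‖f‖))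
      * (p.prod μ) {q | cons q.1 q.2 ∈ S} := by
  rw [normalizedDual, ProbabilityMeasure.coe_mk,
    Measure.map_apply continuous_cons.measurable hS, tilted_apply, ← setLIntegral_const]
  refine lintegral_mono fun q => ENNReal.ofReal_le_ofReal ?_
  rw [two_mul, Real.exp_add, ← div_inv_eq_mul, ← Real.exp_neg]
  have hf : f (cons q.1 q.2) ≤ ‖f‖ := (le_abs_self _).trans (f.norm_coe_le_norm _)
  gcongr
  exact exp_neg_norm_le_integral_prod p f μ

theorem normalizedDual_coord_zero_le {B : Set E} (hB : MeasurableSet B) :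
    (normalizedDual p f μ : Measure (ShiftSpace E)) {x | x 0 ∈ B}
      ≤ ENNReal.ofReal (Real.exp (2 * ‖f‖)) * p B := by
  have hS : MeasurableSet {x : ShiftSpace E | x 0 ∈ B} := (continuous_coord 0).measurable hB
  refine (normalizedDual_apply_le p f μ hS).trans_eq ?_
  have h : {q : E × ShiftSpace E | cons q.1 q.2 ∈ {x : ShiftSpace E | x 0 ∈ B}}
      = B ×ˢ Set.univ := by
    ext q; simp
  rw [h, Measure.prod_prod, measure_univ, mul_one]

theorem normalizedDual_coord_succ_le (i : ℕ) {B : Set E} (hB : MeasurableSet B) :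
    (normalizedDual p f μ : Measure (ShiftSpace E)) {x | x (i + 1) ∈ B}
      ≤ ENNReal.ofReal (Real.exp (2 * ‖f‖)) * (μ : Measure (ShiftSpace E)) {x | x i ∈ B} := by
  have hS : MeasurableSet {x : ShiftSpace E | x (i + 1) ∈ B} :=
    (continuous_coord (i + 1)).measurable hB
  refine (normalizedDual_apply_le p f μ hS).trans_eq ?_
  have h : {q : E × ShiftSpace E | cons q.1 q.2 ∈ {x : ShiftSpace E | x (i + 1) ∈ B}}
      = Set.univ ×ˢ {x | x i ∈ B} := by
    ext q; simp
  rw [h, Measure.prod_prod, measure_univ, one_mul]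

variable {μ} in
theorem iterate_normalizedDual_coord_le {B : Set E} (hB : MeasurableSet B)
    (hμ : ∀ i, (μ : Measure (ShiftSpace E)) {x | x i ∈ B} = 0) (n i : ℕ) :
    ((normalizedDual p f)^[n] μ : Measure (ShiftSpace E)) {x | x i ∈ B}
      ≤ ENNReal.ofReal (Real.exp (2 * ‖f‖)) ^ (i + 1) * p B := by
  induction n generalizing i with
  | zero => exact (hμ i).trans_le zero_le
  | succ n ih =>
    rw [Function.iterate_succ_apply']
    cases i with
    | zero => simpa using normalizedDual_coord_zero_le p f _ hB
    | succ i =>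
      rw [pow_succ', mul_assoc]
      exact (normalizedDual_coord_succ_le p f _ i hB).trans (by gcongr; exact ih i)

end NormalizedDual

theorem isTightMeasureSet_of_coord {E : Type*} [MetricSpace E] {S : Set (Measure (ShiftSpace E))}
    (hS : ∀ i, ∀ ε : ℝ≥0∞, 0 < ε → ∃ K : Set E, IsCompact K ∧ ∀ m ∈ S, m {x | x i ∈ Kᶜ} ≤ ε) :
    IsTightMeasureSet S := by
  rw [isTightMeasureSet_iff_exists_isCompact_measure_compl_le]
  intro ε hε
  obtain ⟨δ, hδ₀, hδ⟩ := ENNReal.exists_pos_sum_of_countable hε.ne' ℕ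
  choose K hK hKS using fun i => hS i (δ i) (ENNReal.coe_pos.2 (hδ₀ i))
  refine ⟨{x | ∀ i, x i ∈ K i}, isCompact_pi hK, fun m hm => ?_⟩
  have hcompl : {x : ShiftSpace E | ∀ i, x i ∈ K i}ᶜ = ⋃ i, {x | x i ∈ (K i)ᶜ} := by
    ext x; simp
  rw [hcompl]
  exact (measure_iUnion_le _).trans ((ENNReal.tsum_le_tsum fun i => hKS i m hm).trans hδ.le)

section ConformalMeasure

variable {E : Type*} [MetricSpace E] [MeasurableSpace E] [BorelSpace E]

variable [SecondCountableTopology E] (p : Measure E) [IsProbabilityMeasure p]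

theorem isTightMeasureSet_iterate_normalizedDual [CompleteSpace E] (f : ShiftSpace E →ᵇ ℝ)
    (a : E) :
    IsTightMeasureSet {((ν : ProbabilityMeasure (ShiftSpace E)) : Measure (ShiftSpace E)) |
      ν ∈ Set.range fun n => (normalizedDual p f)^[n] (diracProba (ofPi fun _ => a))} := by
  refine isTightMeasureSet_of_coord fun i ε hε => ?_
  set c := ENNReal.ofReal (Real.exp (2 * ‖f‖)) ^ (i + 1)
  have hc₀ : c ≠ 0 := by simp [c, Real.exp_pos]
  have hc : c ≠ ∞ := by simp [c]
  obtain ⟨K, hK, hpK⟩ := isTightMeasureSet_iff_exists_isCompact_measure_compl_le.1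
    (isTightMeasureSet_singleton (μ := p)) (c⁻¹ * ε)
    (ENNReal.mul_pos (ENNReal.inv_ne_zero.2 hc) hε.ne')
  have hKa : IsCompact (insert a K) := hK.insert a
  refine ⟨insert a K, hKa, ?_⟩
  rintro _ ⟨_, ⟨n, rfl⟩, rfl⟩
  have hdirac : ∀ j, (diracProba (ofPi fun _ => a) : Measure (ShiftSpace E))
      {x | x j ∈ (insert a K)ᶜ} = 0 := fun j => by
    have hS : MeasurableSet {x : ShiftSpace E | x j ∈ (insert a K)ᶜ} :=
      (continuous_coord j).measurable hKa.measurableSet.compl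
    rw [diracProba_toMeasure_apply' _ hS, Set.indicator_of_notMem]
    exact fun h => h (Set.mem_insert a K)
  calc _ ≤ c * p (insert a K)ᶜ :=
        iterate_normalizedDual_coord_le p f hKa.measurableSet.compl hdirac n i
    _ ≤ c * (c⁻¹ * ε) := by
        gcongr
        exact (measure_mono (Set.compl_subset_compl.2 (Set.subset_insert a K))).trans (hpK p rfl)
    _ = ε := by rw [← mul_assoc, ENNReal.mul_inv_cancel hc₀ hc, one_mul]

variable {α : ℝ≥0}

theorem abs_ruelleCLM_pow_div_sub_integral_le (f φ : ShiftSpace E →ᵇ ℝ)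
    (μ : ProbabilityMeasure (ShiftSpace E)) {n : ℕ} {B : ℝ}
    (hB : ∀ x y, |(ruelleCLM p f ^ n) φ x / (ruelleCLM p f ^ n) 1 x
      - (ruelleCLM p f ^ n) φ y / (ruelleCLM p f ^ n) 1 y| ≤ B) (x : ShiftSpace E) :
    |(ruelleCLM p f ^ n) φ x / (ruelleCLM p f ^ n) 1 x
      - ∫ y, φ y ∂((normalizedDual p f)^[n] μ : Measure (ShiftSpace E))| ≤ B := by
  have hw : ∀ x, 0 < (ruelleCLM p f ^ n) 1 x := ruelleCLM_pow_pos (fun _ => one_pos) n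
  have hμ := integral_pos_of_forall_pos (μ : Measure (ShiftSpace E)) hw
  rw [integral_iterate_normalizedDual]
  set c := (∫ y, (ruelleCLM p f ^ n) φ y ∂(μ : Measure (ShiftSpace E)))
    / ∫ y, (ruelleCLM p f ^ n) 1 y ∂(μ : Measure (ShiftSpace E))
  have hsub : ∀ x, ((ruelleCLM p f ^ n) φ x / (ruelleCLM p f ^ n) 1 x - c)
      * (ruelleCLM p f ^ n) 1 x = (ruelleCLM p f ^ n) φ x - c * (ruelleCLM p f ^ n) 1 x :=
    fun x => by rw [sub_mul, div_mul_cancel₀ _ (hw x).ne']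
  have hφ := ((ruelleCLM p f ^ n) φ).integrable (μ : Measure (ShiftSpace E))
  have h₁ := (((ruelleCLM p f ^ n) 1).integrable (μ : Measure (ShiftSpace E))).const_mul c
  refine abs_sub_le_of_integral_sub_mul_eq_zero (ν := μ) hw ?_ ?_ hB x <;> simp only [hsub]
  · exact hφ.sub h₁
  · rw [integral_sub hφ h₁, integral_const_mul, div_mul_cancel₀ _ hμ.ne', sub_self]

theorem exists_abs_integral_iterate_normalizedDual_sub_le (hα : 0 < α)
    (f : Hol (ShiftSpace E) α) :
    ∃ C r : ℝ, 0 ≤ r ∧ r < 1 ∧ ∀ (μ μ' : ProbabilityMeasure (ShiftSpace E))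
      (φ : ShiftSpace E →ᵇ ℝ) (B : ℝ), 0 ≤ B → HolderBound α B φ → ∀ n : ℕ,
      |∫ x, φ x ∂((normalizedDual p f.toBCF)^[n] μ : Measure (ShiftSpace E))
        - ∫ x, φ x ∂((normalizedDual p f.toBCF)^[n] μ' : Measure (ShiftSpace E))|
        ≤ C * r ^ n * B := by
  obtain ⟨C, r, hC, hr₀, hr, hcontr⟩ := exists_holderBound_ruelleCLM_pow_div p hα f
  refine ⟨2 * C, r, hr₀.le, hr, fun μ μ' φ B hB₀ hφ n => ?_⟩
  obtain ⟨x⟩ : Nonempty (ShiftSpace E) :=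
    nonempty_of_isProbabilityMeasure (μ : Measure (ShiftSpace E))
  have hosc : ∀ x y, |(ruelleCLM p f.toBCF ^ n) φ x / (ruelleCLM p f.toBCF ^ n) 1 x
      - (ruelleCLM p f.toBCF ^ n) φ y / (ruelleCLM p f.toBCF ^ n) 1 y| ≤ C * r ^ n * B :=
    fun x y =>
      (hcontr 1 φ B (LogHolder.one f.distortion_nonneg) hB₀ (by simpa using hφ) n x y).trans
        (mul_le_of_le_one_right (by positivity) (dist_rpow_mem_Icc x y α).2)
  have h := abs_ruelleCLM_pow_div_sub_integral_le p f.toBCF φ μ hosc x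
  have h' := abs_ruelleCLM_pow_div_sub_integral_le p f.toBCF φ μ' hosc x
  rw [abs_sub_comm] at h
  exact (abs_sub_le _ _ _).trans ((add_le_add h h').trans_eq (by ring))

variable [CompleteSpace E]

theorem exists_normalizedDual_eq_self (hα : 0 < α) (hα₁ : α ≤ 1) (f : Hol (ShiftSpace E) α) :
    ∃ ν, normalizedDual p f.toBCF ν = ν := by
  obtain ⟨a⟩ : Nonempty E := nonempty_of_isProbabilityMeasure p
  set G := normalizedDual p f.toBCF
  set δ : ProbabilityMeasure (ShiftSpace E) := diracProba (ofPi fun _ => a)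
  obtain ⟨ν, -, k, hk, hν⟩ := (isCompact_closure_of_isTightMeasureSet
    (isTightMeasureSet_iterate_normalizedDual p f.toBCF a)).tendsto_subseq
    fun n => subset_closure (Set.mem_range_self n)
  have hGν : Tendsto (fun n => G^[k n] (G δ)) atTop (𝓝 (G ν)) := by
    simpa only [← Function.iterate_succ_apply, Function.iterate_succ_apply'] using!
      ((continuous_normalizedDual p f.toBCF).tendsto ν).comp hν
  refine ⟨ν, tendsto_nhds_unique hGν ?_⟩
  obtain ⟨C, r, hr₀, hr, hC⟩ := exists_abs_integral_iterate_normalizedDual_sub_le p hα f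
  rw [tendsto_iff_forall_lipschitz_integral_tendsto]
  rintro φ hφ ⟨K, hK⟩
  obtain ⟨B, hB⟩ := (holderWith_one.2 hK).memHolder.of_le hα₁
  let φ' : ShiftSpace E →ᵇ ℝ := .mkOfBound ⟨φ, hK.continuous⟩ hφ.choose hφ.choose_spec
  have hlim : Tendsto (fun n => ∫ x, φ x ∂(G^[k n] δ : Measure (ShiftSpace E))) atTop
      (𝓝 (∫ x, φ x ∂(ν : Measure (ShiftSpace E)))) :=
    ProbabilityMeasure.tendsto_iff_forall_integral_tendsto.1 hν φ'
  have hdiff : Tendsto (fun n => ∫ x, φ x ∂(G^[k n] (G δ) : Measure (ShiftSpace E))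
      - ∫ x, φ x ∂(G^[k n] δ : Measure (ShiftSpace E))) atTop (𝓝 0) := by
    refine squeeze_zero_norm (fun n => hC (G δ) δ φ' B B.2 (holderBound_coe_iff.2 hB) (k n)) ?_
    simpa using (((tendsto_pow_atTop_nhds_zero_of_lt_one hr₀ hr).comp
      hk.tendsto_atTop).const_mul C).mul_const (B : ℝ)
  simpa using hdiff.add hlim

theorem exists_isConformal (hα : 0 < α) (f : Hol (ShiftSpace E) α) :
    ∃ (ν : Measure (ShiftSpace E)) (lam : ℝ), IsProbabilityMeasure ν ∧ IsConformal p f ν lam := by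
  let f' : Hol (ShiftSpace E) (min α 1) := ⟨f.toBCF, f.memHolder.of_le (min_le_left α 1)⟩
  obtain ⟨ν, hν⟩ := exists_normalizedDual_eq_self p (lt_min hα one_pos) (min_le_right α 1) f'
  exact ⟨ν, _, inferInstance, isConformal_of_normalizedDual_eq_self p f.toBCF ν hν⟩

end ConformalMeasure

/-! ### The mean operator and the normalized operator -/

namespace Hol

section Mean

variable {X : Type*} [MetricSpace X] {α : ℝ≥0}

theorem constants_eq_span : constants X α = ℝ ∙ (1 : Hol X α) := by
  ext φ
  rw [Submodule.mem_span_singleton]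
  constructor
  · rintro ⟨c, hc⟩
    exact ⟨c, ext fun x => by simp [hc x]⟩
  · rintro ⟨c, rfl⟩
    exact ⟨c, fun x => by simp⟩

theorem isClosed_constants : IsClosed (constants X α : Set (Hol X α)) := by
  rw [constants_eq_span]
  exact Submodule.closed_of_finiteDimensional _

theorem apply_eq_self_of_mem_constants {T : Hol X α →L[ℝ] Hol X α} (hT : T 1 = 1) {φ : Hol X α}
    (hφ : φ ∈ constants X α) : T φ = φ := by
  rw [constants_eq_span, Submodule.mem_span_singleton] at hφ
  obtain ⟨c, rfl⟩ := hφ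
  rw [map_smul, hT]

variable [MeasurableSpace X] [OpensMeasurableSpace X]

/-- The functional `φ ↦ ∫ φ w dν`. -/
def weightedIntegral (ν : Measure X) [IsFiniteMeasure ν] (w : X →ᵇ ℝ) : Hol X α →L[ℝ] ℝ :=
  LinearMap.mkContinuousOfExistsBound
    { toFun := fun φ => ∫ x, φ x * w x ∂ν
      map_add' := fun φ ψ => by
        simp only [add_apply, add_mul]
        exact integral_add ((φ.toBCF * w).integrable ν) ((ψ.toBCF * w).integrable ν)
      map_smul' := fun c φ => by
        simp only [smul_apply, mul_assoc]
        exact integral_const_mul _ _ }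
    ⟨‖w‖ * ν.real Set.univ, fun φ => by
      refine (norm_integral_le_of_norm_le_const (C := ‖φ‖ * ‖w‖) (ae_of_all _ fun x => ?_)).trans
        (by ring_nf; rfl)
      rw [norm_mul]
      exact mul_le_mul (φ.abs_le_norm x) (w.norm_coe_le_norm x) (norm_nonneg _) (norm_nonneg _)⟩

/-- The operator `φ ↦ ∫ φ w dν`, with values in the constant functions. -/
def meanOperator (ν : Measure X) [IsFiniteMeasure ν] (w : X →ᵇ ℝ) : Hol X α →L[ℝ] Hol X α :=
  (weightedIntegral ν w).smulRight 1

variable {ν : Measure X} [IsFiniteMeasure ν] {w : X →ᵇ ℝ}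

theorem meanOperator_apply (φ : Hol X α) (x : X) :
    meanOperator ν w φ x = ∫ y, φ y * w y ∂ν := mul_one _

theorem meanOperator_mem_constants (φ : Hol X α) : meanOperator ν w φ ∈ constants X α :=
  ⟨_, meanOperator_apply φ⟩

theorem meanOperator_one (hw : ∫ x, w x ∂ν = 1) : meanOperator ν w (1 : Hol X α) = 1 := by
  ext x
  simpa [meanOperator_apply] using hw

theorem isIdempotentElem_meanOperator (hw : ∫ x, w x ∂ν = 1) :
    IsIdempotentElem (meanOperator ν w : Hol X α →L[ℝ] Hol X α) :=
  ContinuousLinearMap.ext fun φ =>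
    apply_eq_self_of_mem_constants (meanOperator_one hw) (meanOperator_mem_constants φ)

theorem isCompl_constants_ker_meanOperator (hw : ∫ x, w x ∂ν = 1) :
    IsCompl (constants X α) (LinearMap.ker (meanOperator ν w).toLinearMap) :=
  LinearMap.IsProj.isCompl ⟨meanOperator_mem_constants, fun _ hφ =>
    apply_eq_self_of_mem_constants (meanOperator_one hw) hφ⟩

end Mean

theorem norm_le_of_integral_mul_eq_zero {E : Type*} [MetricSpace E] {α : ℝ≥0}
    {ν : Measure (ShiftSpace E)} [IsProbabilityMeasure ν] {w : ShiftSpace E →ᵇ ℝ} {B : ℝ}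
    {φ : Hol (ShiftSpace E) α} (hw : ∀ x, 0 < w x) (h₀ : ∫ x, φ x * w x ∂ν = 0) (hB : 0 ≤ B)
    (hφ : HolderBound α B φ) : ‖φ‖ ≤ 2 * B := by
  rw [two_mul]
  refine norm_le_add φ hB hB (fun x => ?_) hφ
  have h := abs_sub_le_of_integral_sub_mul_eq_zero (g := φ) (c := 0) (B := B) hw
    (by simpa only [sub_zero] using! (φ.toBCF * w).integrable ν) (by simpa only [sub_zero] using h₀)
    (fun x y => (hφ x y).trans (mul_le_of_le_one_right hB (dist_rpow_mem_Icc x y α).2)) x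
  rwa [sub_zero] at h

end Hol

namespace IsNormalizedEigenfunction

variable {E : Type*} [MetricSpace E] [MeasurableSpace E] {p : Measure E}
  {ν : Measure (ShiftSpace E)} {lam : ℝ} {α : ℝ≥0} {f H : Hol (ShiftSpace E) α}

theorem pow_mul_pos (hH : IsNormalizedEigenfunction p f ν lam H) (x : ShiftSpace E) (n : ℕ) :
    0 < lam ^ n * H x :=
  mul_pos (pow_pos hH.lam_pos n) (hH.logHolder.pos x)

theorem mem_Icc_exp_distortion [IsProbabilityMeasure ν]
    (hH : IsNormalizedEigenfunction p f ν lam H) (x : ShiftSpace E) :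
    H x ∈ Set.Icc (Real.exp (-f.distortion)) (Real.exp f.distortion) :=
  hH.logHolder.mem_Icc_of_integral_eq_one f.distortion_nonneg (H.toBCF.integrable ν)
    hH.integral_eq_one x

variable [OpensMeasurableSpace E] [IsProbabilityMeasure p]

theorem ruelleCLM_pow_apply (hH : IsNormalizedEigenfunction p f ν lam H) (n : ℕ)
    (x : ShiftSpace E) : (ruelleCLM p f.toBCF ^ n) H.toBCF x = lam ^ n * H x := by
  have heigen : ruelleCLM p f.toBCF H.toBCF = lam • H.toBCF :=
    BoundedContinuousFunction.ext hH.ruelle_eq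
  have hpow : (ruelleCLM p f.toBCF ^ n) H.toBCF = lam ^ n • H.toBCF := by
    induction n with
    | zero => simp
    | succ n ih => rw [ruelleCLM_pow_succ_apply, ih, map_smul, heigen, smul_smul, pow_succ]
  rw [hpow]
  rfl

theorem le_ruelleCLM_pow_mul_div (hH : IsNormalizedEigenfunction p f ν lam H)
    {u : ShiftSpace E →ᵇ ℝ} {m : ℝ} (hu : ∀ x, m ≤ u x) (n : ℕ) (x : ShiftSpace E) :
    m ≤ (ruelleCLM p f.toBCF ^ n) (H.toBCF * u) x / (lam ^ n * H x) := by
  rw [le_div_iff₀ (hH.pow_mul_pos x n), ← hH.ruelleCLM_pow_apply]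
  refine mul_ruelleCLM_pow_le (fun y => ?_) n x
  rw [mul_comm]
  exact mul_le_mul_of_nonneg_left (hu y) (hH.logHolder.pos y).le

theorem exists_holderBound_ruelleCLM_pow_mul_div (hH : IsNormalizedEigenfunction p f ν lam H)
    (hα : 0 < α) : ∃ C r : ℝ, 0 < C ∧ 0 < r ∧ r < 1 ∧
      ∀ (φ : Hol (ShiftSpace E) α) (n : ℕ), HolderBound α (C * r ^ n * ‖φ‖)
        fun x => (ruelleCLM p f.toBCF ^ n) (H.toBCF * φ.toBCF) x / (lam ^ n * H x) := by
  obtain ⟨C, r, hC, hr₀, hr₁, hcontr⟩ := exists_holderBound_ruelleCLM_pow_div p hα f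
  refine ⟨C, r, hC, hr₀, hr₁, fun φ n => ?_⟩
  simpa only [hH.ruelleCLM_pow_apply] using hcontr H.toBCF (H.toBCF * φ.toBCF) ‖φ‖ hH.logHolder
    (norm_nonneg φ) (by simpa [mul_div_cancel_left₀ _ (hH.logHolder.pos _).ne'] using
      φ.holderBound_norm) n

theorem exists_holderBound_ruelleCLM_mul_div (hH : IsNormalizedEigenfunction p f ν lam H)
    (hα : 0 < α) : ∃ C : ℝ, 0 < C ∧ ∀ φ : Hol (ShiftSpace E) α, HolderBound α (C * ‖φ‖)
      fun x => ruelleCLM p f.toBCF (H.toBCF * φ.toBCF) x / (lam * H x) := by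
  obtain ⟨C, r, hC, hr₀, -, hcontr⟩ := hH.exists_holderBound_ruelleCLM_pow_mul_div hα
  exact ⟨C * r, by positivity, fun φ => by simpa using hcontr φ 1⟩

theorem abs_ruelleCLM_mul_div_le (hH : IsNormalizedEigenfunction p f ν lam H)
    (u : ShiftSpace E →ᵇ ℝ) (x : ShiftSpace E) :
    |ruelleCLM p f.toBCF (H.toBCF * u) x / (lam * H x)| ≤ ‖u‖ := by
  have hlower := hH.le_ruelleCLM_pow_mul_div (fun y => (abs_le.1 (u.norm_coe_le_norm y)).1) 1 x
  have hupper := hH.le_ruelleCLM_pow_mul_div (u := -u) (m := -‖u‖)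
    (fun y => neg_le_neg (abs_le.1 (u.norm_coe_le_norm y)).2) 1 x
  have hneg : H.toBCF * -u = -(H.toBCF * u) :=
    BoundedContinuousFunction.ext fun y => mul_neg (H y) (u y)
  rw [hneg, map_neg, BoundedContinuousFunction.neg_apply, neg_div, neg_le_neg_iff] at hupper
  rw [pow_one, pow_one] at hlower hupper
  exact abs_le.2 ⟨hlower, hupper⟩

/-- The operator `Q φ = L_f (H φ) / (lam H)`, normalized to fix the constant functions. -/
def normalizedOperator (hH : IsNormalizedEigenfunction p f ν lam H) (hα : 0 < α) :
    Hol (ShiftSpace E) α →L[ℝ] Hol (ShiftSpace E) α :=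
  LinearMap.mkContinuousOfExistsBound
    { toFun := fun φ => Hol.ofHolderBound hα
        (fun x => ruelleCLM p f.toBCF (H.toBCF * φ.toBCF) x / (lam * H x))
        ((hH.exists_holderBound_ruelleCLM_mul_div hα).elim fun C h => ⟨C * ‖φ‖, h.2 φ⟩)
      map_add' := fun φ ψ => by
        ext x
        simp only [Hol.ofHolderBound_apply, Hol.toBCF_add, mul_add, map_add,
          BoundedContinuousFunction.add_apply, add_div]
      map_smul' := fun c φ => by
        ext x
        simp only [Hol.ofHolderBound_apply, Hol.toBCF_smul, mul_smul_comm,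
          map_smul, BoundedContinuousFunction.smul_apply, smul_eq_mul, mul_div_assoc,
          RingHom.id_apply] }
    ((hH.exists_holderBound_ruelleCLM_mul_div hα).elim fun C h => ⟨1 + C, fun φ => by
      rw [one_add_mul]
      have := h.1
      exact Hol.norm_le_add _ (norm_nonneg φ) (by positivity)
        (fun x => (hH.abs_ruelleCLM_mul_div_le φ.toBCF x).trans φ.norm_toBCF_le) (h.2 φ)⟩)

variable (hH : IsNormalizedEigenfunction p f ν lam H) (hα : 0 < α)

theorem normalizedOperator_apply (φ : Hol (ShiftSpace E) α) (x : ShiftSpace E) :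
    hH.normalizedOperator hα φ x = ruelleCLM p f.toBCF (H.toBCF * φ.toBCF) x / (lam * H x) := rfl

theorem normalizedOperator_pow_apply (n : ℕ) (φ : Hol (ShiftSpace E) α) (x : ShiftSpace E) :
    (hH.normalizedOperator hα ^ n) φ x
      = (ruelleCLM p f.toBCF ^ n) (H.toBCF * φ.toBCF) x / (lam ^ n * H x) := by
  induction n generalizing x with
  | zero => simp [mul_div_cancel_left₀ _ (hH.logHolder.pos x).ne']
  | succ n ih =>
    have hiter : H.toBCF * ((hH.normalizedOperator hα ^ n) φ).toBCF
        = (lam ^ n)⁻¹ • (ruelleCLM p f.toBCF ^ n) (H.toBCF * φ.toBCF) := by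
      ext y
      have := (hH.logHolder.pos y).ne'
      have := hH.lam_pos.ne'
      simp only [BoundedContinuousFunction.coe_mul, Pi.mul_apply, ih y,
        BoundedContinuousFunction.coe_smul, smul_eq_mul]
      field_simp
    rw [pow_succ', mul_apply_eq_comp, normalizedOperator_apply, hiter,
      map_smul, ← ruelleCLM_pow_succ_apply, BoundedContinuousFunction.smul_apply, smul_eq_mul,
      pow_succ lam]
    field_simp

theorem normalizedOperator_pow_div {H' : Hol (ShiftSpace E) α} (hH' : ∀ x, H' x = (H x)⁻¹)
    (φ ψ : Hol (ShiftSpace E) α) (n : ℕ) (x : ShiftSpace E) :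
    (hH.normalizedOperator hα ^ n) (φ * H') x / (hH.normalizedOperator hα ^ n) (ψ * H') x
      = (ruelleCLM p f.toBCF ^ n) φ.toBCF x / (ruelleCLM p f.toBCF ^ n) ψ.toBCF x := by
  have hcancel : ∀ u : Hol (ShiftSpace E) α, H.toBCF * (u * H').toBCF = u.toBCF := fun u =>
    BoundedContinuousFunction.ext fun y => by
      rw [BoundedContinuousFunction.mul_apply, Hol.mul_apply, hH', mul_comm,
        inv_mul_cancel_right₀ (hH.logHolder.pos y).ne']
  rw [normalizedOperator_pow_apply, normalizedOperator_pow_apply, hcancel, hcancel,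
    div_div_div_cancel_right₀ (hH.pow_mul_pos x n).ne']

theorem normalizedOperator_one : hH.normalizedOperator hα 1 = 1 := by
  ext x
  have hone : H.toBCF * (1 : Hol (ShiftSpace E) α).toBCF = H.toBCF := mul_one _
  have hpos := hH.pow_mul_pos x 1
  have heigen := hH.ruelleCLM_pow_apply 1 x
  simp only [pow_one] at hpos heigen
  rw [normalizedOperator_apply, hone, heigen, Hol.one_apply, div_self hpos.ne']

variable [IsProbabilityMeasure ν]

theorem normalizedOperator_comp_meanOperator :
    hH.normalizedOperator hα ∘L Hol.meanOperator ν H.toBCF = Hol.meanOperator ν H.toBCF :=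
  ContinuousLinearMap.ext fun φ => Hol.apply_eq_self_of_mem_constants
    (hH.normalizedOperator_one hα) (Hol.meanOperator_mem_constants φ)

theorem meanOperator_comp_normalizedOperator :
    Hol.meanOperator ν H.toBCF ∘L hH.normalizedOperator hα = Hol.meanOperator ν H.toBCF := by
  ext φ x
  have hcancel : ∀ y, hH.normalizedOperator hα φ y * H y
      = lam⁻¹ * ruelleCLM p f.toBCF (H.toBCF * φ.toBCF) y := fun y => by
    rw [normalizedOperator_apply, div_mul_eq_mul_div,
      mul_div_mul_right _ _ (hH.logHolder.pos y).ne', div_eq_inv_mul]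
  have hconf := hH.toIsConformal.integral_ruelleCLM_pow 1 (H.toBCF * φ.toBCF)
  rw [pow_one, pow_one] at hconf
  rw [ContinuousLinearMap.comp_apply, Hol.meanOperator_apply, Hol.meanOperator_apply]
  simp only [hcancel]
  rw [integral_const_mul, hconf, inv_mul_cancel_left₀ hH.lam_pos.ne']
  simp only [BoundedContinuousFunction.coe_mul, Pi.mul_apply, mul_comm]

end IsNormalizedEigenfunction

/-! ### The spectral gap and decay rates -/

theorem sub_pow_succ_of_mul_eq {R : Type*} [Ring R] {q e : R} (hqe : q * e = e) (heq : e * q = e)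
    (he : IsIdempotentElem e) (n : ℕ) : (q - e) ^ (n + 1) = q ^ (n + 1) - e := by
  have hpow : ∀ k, q ^ k * e = e := fun k => by
    induction k with
    | zero => rw [pow_zero, one_mul]
    | succ k ih => rw [pow_succ, mul_assoc, hqe, ih]
  induction n with
  | zero => rw [zero_add, pow_one, pow_one]
  | succ n ih => rw [pow_succ, ih, sub_mul, mul_sub, mul_sub, ← pow_succ, hpow, heq, he.eq,
      sub_self, sub_zero]

theorem iSup_abs_one_div_pos {X : Type*} [Nonempty X] {ψ : X → ℝ} {c : ℝ} (hc : 0 < c)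
    (hψ : ∀ x, c ≤ ψ x) : 0 < ⨆ x, |1 / ψ x| := by
  obtain ⟨x⟩ := ‹Nonempty X›
  have hpos : ∀ y, 0 < 1 / ψ y := fun y => one_div_pos.2 (hc.trans_le (hψ y))
  have hbdd : BddAbove (Set.range fun y => |1 / ψ y|) := ⟨1 / c, Set.forall_mem_range.2 fun y =>
    (abs_of_pos (hpos y)).trans_le (one_div_le_one_div_of_le hc (hψ y))⟩
  exact (abs_pos.2 (hpos x).ne').trans_le (le_ciSup hbdd x)

section DecayRate

variable {E : Type*} [MetricSpace E] {α : ℝ≥0} {ψ : Hol (ShiftSpace E) α} {c : ℝ}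
  [MeasurableSpace E] [OpensMeasurableSpace E] {p : Measure E} [IsProbabilityMeasure p]
  {ν : Measure (ShiftSpace E)} [IsProbabilityMeasure ν] {f : Hol (ShiftSpace E) α} {s : ℝ}

theorem IsDecayRate.exists_holderBound (hs : IsDecayRate p f ν α s) (hs₀ : 0 ≤ s) (hc : 0 < c)
    (hψ : ∀ x, c ≤ ψ x) : ∃ C : ℝ, 0 < C ∧ ∀ (φ : Hol (ShiftSpace E) α) (n : ℕ),
      HolderBound α (C * s ^ n * ‖φ‖) fun x =>
        (ruelleCLM p f.toBCF ^ n) φ.toBCF x / (ruelleCLM p f.toBCF ^ n) ψ.toBCF x := by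
  obtain ⟨C, hC, hdecay⟩ := hs ψ ⟨c, hc, hψ⟩
  have := ν.nonempty_of_neZero
  have hS : 0 < ⨆ x, |1 / ψ x| := iSup_abs_one_div_pos hc hψ
  set S := ⨆ x, |1 / ψ x|
  set J := ∫ x, ψ x ∂ν
  refine ⟨C * (1 + |J|⁻¹ * ‖ψ‖) * S, by positivity, fun φ n => ?_⟩
  have hmean : |(∫ x, φ x ∂ν) / J| ≤ ‖φ‖ * |J|⁻¹ := by
    rw [abs_div, div_eq_mul_inv]
    gcongr
    exact (φ.toBCF.norm_integral_le_norm ν).trans φ.norm_toBCF_le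
  have hiter : ∀ u : ShiftSpace E →ᵇ ℝ, (ruelle p f)^[n] u = (ruelleCLM p f.toBCF ^ n) u :=
    iterate_ruelle p f.toBCF n
  have h := HolderBound.of_eHolderNorm_le (by positivity) (hdecay φ n)
  simp only [hiter] at h
  have h' := h.sub_const (-((∫ x, φ x ∂ν) / J))
  simp only [sub_neg_eq_add, sub_add_cancel] at h'
  refine h'.mono ?_
  have hφ : (nnHolderNorm α φ : ℝ) ≤ ‖φ‖ := le_add_of_nonneg_left (norm_nonneg _)
  have hψ' : (nnHolderNorm α ψ : ℝ) ≤ ‖ψ‖ := le_add_of_nonneg_left (norm_nonneg _)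
  calc _ ≤ C * s ^ n * (‖φ‖ + ‖φ‖ * |J|⁻¹ * ‖ψ‖) * S := by gcongr
    _ = _ := by ring

end DecayRate

namespace IsNormalizedEigenfunction

variable {E : Type*} [MetricSpace E] [MeasurableSpace E] [OpensMeasurableSpace E]
  {p : Measure E} [IsProbabilityMeasure p] {ν : Measure (ShiftSpace E)} {lam : ℝ} {α : ℝ≥0}
  {f H : Hol (ShiftSpace E) α} [IsProbabilityMeasure ν]
  (hH : IsNormalizedEigenfunction p f ν lam H) (hα : 0 < α)

theorem normalizedOperator_sub_meanOperator_pow_succ (n : ℕ) :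
    (hH.normalizedOperator hα - Hol.meanOperator ν H.toBCF) ^ (n + 1)
      = hH.normalizedOperator hα ^ (n + 1) - Hol.meanOperator ν H.toBCF :=
  sub_pow_succ_of_mul_eq (hH.normalizedOperator_comp_meanOperator hα)
    (hH.meanOperator_comp_normalizedOperator hα)
    (Hol.isIdempotentElem_meanOperator hH.integral_eq_one) n

theorem meanOperator_comp_normalizedOperator_pow (n : ℕ) (φ : Hol (ShiftSpace E) α) :
    Hol.meanOperator ν H.toBCF ((hH.normalizedOperator hα ^ n) φ)
      = Hol.meanOperator ν H.toBCF φ := by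
  induction n with
  | zero => rfl
  | succ n ih =>
    rw [pow_succ', mul_apply_eq_comp, ← ContinuousLinearMap.comp_apply,
      hH.meanOperator_comp_normalizedOperator, ih]

theorem norm_normalizedOperator_pow_sub_le {B : ℝ} (hB : 0 ≤ B) (n : ℕ)
    (h : ∀ φ : Hol (ShiftSpace E) α, HolderBound α (B * ‖φ‖)
      fun x => (ruelleCLM p f.toBCF ^ n) (H.toBCF * φ.toBCF) x / (lam ^ n * H x)) :
    ‖hH.normalizedOperator hα ^ n - Hol.meanOperator ν H.toBCF‖ ≤ 2 * B := by
  refine ContinuousLinearMap.opNorm_le_bound _ (by positivity) fun φ => ?_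
  rw [mul_assoc]
  refine Hol.norm_le_of_integral_mul_eq_zero (ν := ν) (w := H.toBCF) hH.logHolder.pos ?_
    (by positivity) ?_
  · obtain ⟨x⟩ := ν.nonempty_of_neZero
    rw [← Hol.meanOperator_apply _ x, sub_apply, map_sub,
      hH.meanOperator_comp_normalizedOperator_pow, ← mul_apply_eq_comp,
      (Hol.isIdempotentElem_meanOperator hH.integral_eq_one).eq, sub_self]
    rfl
  · convert (h φ).sub_const (∫ y, φ y * H y ∂ν) using 1
    funext x
    rw [sub_apply, Hol.sub_apply, normalizedOperator_pow_apply, Hol.meanOperator_apply]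

theorem exists_norm_normalizedOperator_pow_sub_le : ∃ C r : ℝ, 0 < C ∧ 0 < r ∧ r < 1 ∧
    ∀ n : ℕ, ‖hH.normalizedOperator hα ^ n - Hol.meanOperator ν H.toBCF‖ ≤ C * r ^ n := by
  obtain ⟨C, r, hC, hr₀, hr₁, h⟩ := hH.exists_holderBound_ruelleCLM_pow_mul_div hα
  refine ⟨2 * C, r, by positivity, hr₀, hr₁, fun n => ?_⟩
  rw [mul_assoc]
  exact hH.norm_normalizedOperator_pow_sub_le hα (by positivity) n fun φ => h φ n

theorem exists_norm_pow_le_of_isDecayRate {s : ℝ} (hs₀ : 0 < s) (hs : IsDecayRate p f ν α s) :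
    ∃ C : ℝ, 0 < C ∧ ∀ n : ℕ,
      ‖(hH.normalizedOperator hα - Hol.meanOperator ν H.toBCF) ^ n‖ ≤ C * s ^ n := by
  obtain ⟨C, hC, hdecay⟩ := hs.exists_holderBound hs₀.le (Real.exp_pos _)
    fun x => (hH.mem_Icc_exp_distortion x).1
  have hbound : ∀ n (φ : Hol (ShiftSpace E) α), HolderBound α (C * ‖H‖ * s ^ n * ‖φ‖)
      fun x => (ruelleCLM p f.toBCF ^ n) (H.toBCF * φ.toBCF) x / (lam ^ n * H x) := fun n φ => by
    have h := (hdecay (H * φ) n).mono (mul_le_mul_of_nonneg_left (Hol.norm_mul_le H φ)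
      (by positivity))
    simp only [hH.ruelleCLM_pow_apply] at h
    exact h.mono (le_of_eq (by ring))
  refine ⟨2 * (C * ‖H‖) + 1, by positivity, fun n => ?_⟩
  cases n with
  | zero =>
    rw [pow_zero, pow_zero, mul_one]
    exact ContinuousLinearMap.norm_id_le.trans (le_add_of_nonneg_left (by positivity))
  | succ n =>
    rw [normalizedOperator_sub_meanOperator_pow_succ]
    refine (hH.norm_normalizedOperator_pow_sub_le hα (by positivity) _ (hbound (n + 1))).trans ?_
    rw [← mul_assoc]
    gcongr
    exact le_add_of_nonneg_right zero_le_one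

theorem exists_norm_inv_normalizedOperator_pow_le {u : Hol (ShiftSpace E) α} {m : ℝ} (hm : 0 < m)
    (hu : ∀ x, m ≤ u x) : ∃ A : ℝ, 0 < A ∧ ∀ n : ℕ, ∃ g : Hol (ShiftSpace E) α,
      (∀ x, g x = ((hH.normalizedOperator hα ^ n) u x)⁻¹) ∧ ‖g‖ ≤ A := by
  obtain ⟨C, r, hC, hr₀, hr₁, hgap⟩ := hH.exists_norm_normalizedOperator_pow_sub_le hα
  set Q := hH.normalizedOperator hα
  set P : Hol (ShiftSpace E) α →L[ℝ] Hol (ShiftSpace E) α := Hol.meanOperator ν H.toBCF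
  have hQ : ∀ n, ‖Q ^ n‖ ≤ C + ‖P‖ := fun n =>
    (norm_le_norm_sub_add _ P).trans <| add_le_add_left
      ((hgap n).trans (mul_le_of_le_one_right hC.le (pow_le_one₀ hr₀.le hr₁.le))) _
  refine ⟨m⁻¹ + (C + ‖P‖) * ‖u‖ / m ^ 2, by positivity, fun n => ?_⟩
  have hlow : ∀ x, m ≤ (Q ^ n) u x := fun x => by
    rw [normalizedOperator_pow_apply]
    exact hH.le_ruelleCLM_pow_mul_div hu n x
  obtain ⟨g, hg, hnorm⟩ := Hol.exists_eq_inv hα _ hm hlow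
  exact ⟨g, hg, hnorm.trans (by gcongr; exact (Q ^ n).le_of_opNorm_le (hQ n) u)⟩

include hH hα in
theorem exists_holderBound_div_of_integral_eq_zero :
    ∃ r : ℝ, 0 < r ∧ r < 1 ∧ ∀ (ψ : Hol (ShiftSpace E) α) (c : ℝ), 0 < c → (∀ x, c ≤ ψ x) →
      ∃ C : ℝ, 0 < C ∧ ∀ φ : Hol (ShiftSpace E) α, ∫ x, φ x ∂ν = 0 → ∀ n : ℕ,
        HolderBound α (C * r ^ n * ‖φ‖) fun x =>
          (ruelleCLM p f.toBCF ^ n) φ.toBCF x / (ruelleCLM p f.toBCF ^ n) ψ.toBCF x := by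
  obtain ⟨C, r, hC, hr₀, hr₁, hgap⟩ := hH.exists_norm_normalizedOperator_pow_sub_le hα
  obtain ⟨H', hH', -⟩ := Hol.exists_eq_inv hα H (Real.exp_pos _)
    fun x => (hH.mem_Icc_exp_distortion x).1
  refine ⟨r, hr₀, hr₁, fun ψ c hc hψ => ?_⟩
  have hlow : ∀ x, c * Real.exp (-f.distortion) ≤ (ψ * H') x := fun x => by
    rw [Hol.mul_apply, hH', Real.exp_neg]
    exact mul_le_mul (hψ x) (inv_anti₀ (hH.logHolder.pos x) ((hH.mem_Icc_exp_distortion x).2))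
      (by positivity) (hc.le.trans (hψ x))
  obtain ⟨A, hA, hinv⟩ := hH.exists_norm_inv_normalizedOperator_pow_le hα (by positivity) hlow
  refine ⟨C * (‖H'‖ + 1) * A, by positivity, fun φ hφ n => ?_⟩
  set q := (hH.normalizedOperator hα ^ n) (φ * H')
  have hmean : Hol.meanOperator ν H.toBCF (φ * H') = 0 := Hol.ext fun x => by
    rw [Hol.meanOperator_apply]
    refine Eq.trans (integral_congr_ae (.of_forall fun y => ?_)) hφ
    simp only [Hol.mul_apply, hH']
    exact inv_mul_cancel_right₀ (hH.logHolder.pos y).ne' _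
  have hq : ‖q‖ ≤ C * r ^ n * (‖φ‖ * ‖H'‖) := by
    have h := ContinuousLinearMap.le_of_opNorm_le_of_le _ (hgap n) (Hol.norm_mul_le φ H')
    rwa [sub_apply, hmean, sub_zero] at h
  obtain ⟨g, hg, hgA⟩ := hinv n
  have hqg : ‖q * g‖ ≤ C * (‖H'‖ + 1) * A * r ^ n * ‖φ‖ := calc
    ‖q * g‖ ≤ C * r ^ n * (‖φ‖ * (‖H'‖ + 1)) * A := (Hol.norm_mul_le q g).trans <| by
      gcongr
      exact hq.trans (by gcongr; exact le_add_of_nonneg_right zero_le_one)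
    _ = _ := by ring
  convert (q * g).holderBound_norm.mono hqg using 1
  funext x
  rw [Hol.mul_apply, hg, ← div_eq_mul_inv, hH.normalizedOperator_pow_div hα hH']

include hH hα in
theorem exists_isDecayRate : ∃ s : ℝ, 0 < s ∧ s < 1 ∧ IsDecayRate p f ν α s := by
  obtain ⟨r, hr₀, hr₁, hratio⟩ := hH.exists_holderBound_div_of_integral_eq_zero hα
  refine ⟨r, hr₀, hr₁, fun ψ ⟨c, hc, hψ⟩ => ?_⟩
  obtain ⟨C, hC, hbound⟩ := hratio ψ c hc hψ
  have := ν.nonempty_of_neZero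
  have hS : 0 < ⨆ x, |1 / ψ x| := iSup_abs_one_div_pos hc hψ
  have hψpos : ∀ x, 0 < ψ x := fun x => hc.trans_le (hψ x)
  have hJ : ∫ x, ψ x ∂ν ≠ 0 :=
    (hc.trans_le (by simpa using integral_mono (integrable_const c) (ψ.toBCF.integrable ν) hψ)).ne'
  refine ⟨2 * C / ⨆ x, |1 / ψ x|, by positivity, fun φ n => ?_⟩
  set k := (∫ x, φ x ∂ν) / ∫ x, ψ x ∂ν with hk
  have hzero : ∫ x, (φ - k • ψ) x ∂ν = 0 := by
    simp only [Hol.sub_apply, Hol.smul_apply]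
    rw [integral_sub (φ.toBCF.integrable ν) ((ψ.toBCF.integrable ν).const_mul k),
      integral_const_mul, hk, div_mul_cancel₀ _ hJ, sub_self]
  have hnorm : ‖φ - k • ψ‖ ≤ 2 * (nnHolderNorm α φ + |k| * nnHolderNorm α ψ) :=
    Hol.norm_le_of_integral_mul_eq_zero (ν := ν) (w := 1) (fun _ => one_pos)
      (by simpa using hzero) (by positivity)
      (HolderBound.sub_const_mul φ.holderBound ψ.holderBound k)
  have heq : ∀ x, (ruelleCLM p f.toBCF ^ n) (φ - k • ψ).toBCF x
      / (ruelleCLM p f.toBCF ^ n) ψ.toBCF x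
      = (ruelle p f)^[n] φ x / (ruelle p f)^[n] ψ x - k := fun x => by
    rw [iterate_ruelle p f.toBCF n φ.toBCF, iterate_ruelle p f.toBCF n ψ.toBCF, Hol.toBCF_sub,
      Hol.toBCF_smul, map_sub, map_smul, BoundedContinuousFunction.sub_apply,
      BoundedContinuousFunction.smul_apply, smul_eq_mul, sub_div,
      mul_div_cancel_right₀ _ (ruelleCLM_pow_pos hψpos n x).ne']
  have h := hbound (φ - k • ψ) hzero n
  simp only [heq] at h
  refine (h.mono (mul_le_mul_of_nonneg_left hnorm (by positivity))).eHolderNorm_le.trans_eq ?_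
  congr 1
  field_simp

end IsNormalizedEigenfunction

end

theorem proposition3p2_general {E : Type*} [MetricSpace E] [CompleteSpace E]
    [TopologicalSpace.SeparableSpace E] [MeasurableSpace E] [BorelSpace E]
    (p : Measure E) [IsProbabilityMeasure p] (α : ℝ≥0) (hα0 : 0 < α)
    (f : Hol (ShiftSpace E) α) :
    (∃ (ν : Measure (ShiftSpace E)) (lam : ℝ) (h : ShiftSpace E → ℝ), IsPFRData p f ν lam h) ∧
    ∀ (ν : Measure (ShiftSpace E)) (lam : ℝ) (h : ShiftSpace E → ℝ), IsPFRData p f ν lam h →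
      ∃ Q P : Hol (ShiftSpace E) α →L[ℝ] Hol (ShiftSpace E) α,
        (∀ φ x, Q φ x = ruelle p f (fun y => h y * φ y) x / (lam * h x)) ∧
        (∀ φ x, P φ x = ∫ y, φ y * h y ∂ν) ∧
        P ∘L Q = P ∧ Q ∘L P = P ∧
        (∃ s : ℝ, 0 < s ∧ s < 1 ∧ IsDecayRate p f ν α s) ∧
        (∀ s : ℝ, 0 < s → s < 1 → IsDecayRate p f ν α s →
          ∃ C : ℝ, 0 < C ∧ ∀ n : ℕ, ‖(Q - P) ^ n‖ ≤ C * s ^ n) ∧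
        IsCompl (Hol.constants (ShiftSpace E) α) (LinearMap.ker P.toLinearMap) ∧
        IsClosed (Hol.constants (ShiftSpace E) α : Set (Hol (ShiftSpace E) α)) ∧
        IsClosed (LinearMap.ker P.toLinearMap : Set (Hol (ShiftSpace E) α)) ∧
        (∀ φ ∈ Hol.constants (ShiftSpace E) α,
          Q φ ∈ Hol.constants (ShiftSpace E) α ∧ P φ ∈ Hol.constants (ShiftSpace E) α) ∧
        (∀ φ ∈ LinearMap.ker P.toLinearMap,
          Q φ ∈ LinearMap.ker P.toLinearMap ∧ P φ ∈ LinearMap.ker P.toLinearMap) ∧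
        (∀ φ ∈ Hol.constants (ShiftSpace E) α, Q φ = φ ∧ P φ = φ) := by
  have : SecondCountableTopology E := UniformSpace.secondCountable_of_separable E
  refine ⟨?_, fun ν lam h hν => ?_⟩
  · obtain ⟨ν, lam, _, hν⟩ := exists_isConformal p hα0 f
    obtain ⟨h, hh⟩ := hν.exists_isPFRData hα0
    exact ⟨ν, lam, h, hh⟩
  have := hν.isProbabilityMeasure
  obtain ⟨H, hH, hHh⟩ := hν.exists_isNormalizedEigenfunction hα0
  obtain rfl : ⇑H.toBCF = h := funext hHh
  have hQ₁ := hH.normalizedOperator_one hα0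
  have hP₁ := Hol.meanOperator_one (α := α) hH.integral_eq_one
  have hPQ := hH.meanOperator_comp_normalizedOperator hα0
  refine ⟨hH.normalizedOperator hα0, Hol.meanOperator ν H.toBCF,
    hH.normalizedOperator_apply hα0, Hol.meanOperator_apply, hPQ,
    hH.normalizedOperator_comp_meanOperator hα0, hH.exists_isDecayRate hα0,
    fun s hs₀ _ hs => hH.exists_norm_pow_le_of_isDecayRate hα0 hs₀ hs,
    Hol.isCompl_constants_ker_meanOperator hH.integral_eq_one, Hol.isClosed_constants,
    ContinuousLinearMap.isClosed_ker _, fun φ hφ => ⟨?_, Hol.meanOperator_mem_constants φ⟩,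
    fun φ hφ => ?_, fun φ hφ => ⟨Hol.apply_eq_self_of_mem_constants hQ₁ hφ,
      Hol.apply_eq_self_of_mem_constants hP₁ hφ⟩⟩
  · rwa [Hol.apply_eq_self_of_mem_constants hQ₁ hφ]
  · have hPφ : Hol.meanOperator ν H.toBCF φ = 0 := hφ
    exact ⟨(DFunLike.congr_fun hPQ φ).trans hPφ, hPφ ▸ zero_mem _⟩

theorem proposition3p2 {E : Type*} [MetricSpace E] [CompleteSpace E]
    [TopologicalSpace.SeparableSpace E] [MeasurableSpace E] [BorelSpace E]
    (p : Measure E) [IsProbabilityMeasure p] (α : ℝ≥0) (hα0 : 0 < α) (hα1 : α < 1)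
    (f : Hol (ShiftSpace E) α) :
    (∃ (ν : Measure (ShiftSpace E)) (lam : ℝ) (h : ShiftSpace E → ℝ), IsPFRData p f ν lam h) ∧
    ∀ (ν : Measure (ShiftSpace E)) (lam : ℝ) (h : ShiftSpace E → ℝ), IsPFRData p f ν lam h →
      ∃ Q P : Hol (ShiftSpace E) α →L[ℝ] Hol (ShiftSpace E) α,
        (∀ φ x, Q φ x = ruelle p f (fun y => h y * φ y) x / (lam * h x)) ∧
        (∀ φ x, P φ x = ∫ y, φ y * h y ∂ν) ∧
        P ∘L Q = P ∧ Q ∘L P = P ∧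
        (∃ s : ℝ, 0 < s ∧ s < 1 ∧ IsDecayRate p f ν α s) ∧
        (∀ s : ℝ, 0 < s → s < 1 → IsDecayRate p f ν α s →
          ∃ C : ℝ, 0 < C ∧ ∀ n : ℕ, ‖(Q - P) ^ n‖ ≤ C * s ^ n) ∧
        IsCompl (Hol.constants (ShiftSpace E) α) (LinearMap.ker P.toLinearMap) ∧
        IsClosed (Hol.constants (ShiftSpace E) α : Set (Hol (ShiftSpace E) α)) ∧
        IsClosed (LinearMap.ker P.toLinearMap : Set (Hol (ShiftSpace E) α)) ∧
        (∀ φ ∈ Hol.constants (ShiftSpace E) α,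
          Q φ ∈ Hol.constants (ShiftSpace E) α ∧ P φ ∈ Hol.constants (ShiftSpace E) α) ∧
        (∀ φ ∈ LinearMap.ker P.toLinearMap,
          Q φ ∈ LinearMap.ker P.toLinearMap ∧ P φ ∈ LinearMap.ker P.toLinearMap) ∧
        (∀ φ ∈ Hol.constants (ShiftSpace E) α, Q φ = φ ∧ P φ = φ) :=
  proposition3p2_general p α hα0 f
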